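/- **Model.** An arm has true states $1,\dots,M$, a stochastic transition matrix $(p_{kj})$, a stochastic observation matrix $(\varepsilon_{ij})$, rewards $r_{ij}$ (true state $i$, observed state $j$), and feedback probabilities $\rho_{kl}=P(F=l\mid S=k)$, $1\le l\le L$. For a belief $\omega$ in the simplex put $R_\omega=\sum_i\omega_i\sum_j\varepsilon_{ij}r_{ij}$. If the arm is passive the belief moves to $\mathcal B_0\omega=\omega P$. If it is active, feedback $l$ occurs with probability $q_l(\omega)=\sum_k\rho_{kl}\omega_k$ and the belief moves to $\mathcal B_l\omega=\big(\sum_k p_{kj}\rho_{kl}\omega_k/q_l(\omega)\big)_j$ (put $\mathcal B_l\omega=\omega P$ if $q_l(\omega)=0$). Fix an initial belief $\omega_0$; let $S=\Omega(\omega_0)$ be the countable set of all $\mathcal B_{l_1}\cdots\mathcal B_{l_T}\omega_0$, $T\ge 0$, and let $p^1_{ij},p^0_{ij}$ be the transition probabilities on $S$ under the active and the passive action. Let $0\le\beta<1$. In the two-arm problem with subsidy $\lambda\in\mathbb R$ one chooses in each slot $t=0,1,\dots$ between activating the arm at its current belief $\omega(t)$ ($a(t)=1$, expected reward $R_{\omega(t)}$)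 and activating an auxiliary arm with a single state $0$ ($a(t)=0$, reward $\lambda$; the original arm is then passive). Policies may be randomized and may depend on the past beliefs and actions of the original arm. The aim is to maximize the expected total $\beta$-discounted reward. For a policy $\pi$ and an initial state $j\in S$ let $x^1_\omega(\pi,j)=\mathbb E_\pi[\sum_t\beta^t\mathbf 1(\omega(t)=\omega,a(t)=1)\mid\omega(0)=j]$ and $x^1_0(\pi,j)=\mathbb E_\pi[\sum_t\beta^t\mathbf 1(a(t)=0)\mid\omega(0)=j]$. For $\Omega\subseteq S$ let $T^\Omega_j$ and $R^\Omega_j$ be the expected total discounted active time of, and reward from, the original arm started at $j$ when it is active exactly in the states of $\Omega$, and put $$A^\Omega_i=1+\beta\sum_j(p^1_{ij}-p^0_{ij})T^{\Omega^c}_j,\qquad W^\Omega_i=R_i+\beta\sum_j(p^1_{ij}-p^0_{ij})R^{\Omega^c}_j,$$ $b_j(\Omega)=\inf_\pi\sum_{\omega\in\Omega}A^\Omega_\omega x^1_\omega(\pi,j)$ and $b_j(\{0\}\cup\Omega)=\inf_\pi\big(x^1_0(\pi,j)+\sum_{\omega\in\Omega}A^\Omega_\omega x^1_\omega(\pi,j)\big)$.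 **PCL-indexability.** Let $\tilde\Omega$ be a family of subsets of $S$ with $S\in\tilde\Omega$. The partial conservation law (PCL) w.r.t. $\tilde\Omega$ says that for all $\Omega\in\tilde\Omega$, all policies $\pi$ and all initial states $j$: $x^1_0(\pi,j)+\sum_{\omega\in\Omega}A^\Omega_\omega x^1_\omega(\pi,j)\ge b_j(\{0\}\cup\Omega)$, with equality if $\pi$ gives priority to $\Omega^c$ over $0$ (the arm is always activated in $\Omega^c$); $\sum_{\omega\in\Omega}A^\Omega_\omega x^1_\omega(\pi,j)\ge b_j(\Omega)$, with equality if $\pi$ gives priority to $0$ over $\Omega$ (the arm is never activated in $\Omega$); and $x^1_0(\pi,j)+\sum_{\omega\in S}x^1_\omega(\pi,j)=b_j(\{0\}\cup S)$. A full subset chain of $\tilde\Omega$ is a family $C=(\Omega^C_i)_{i\in S}$ of members of $\tilde\Omega$ such that $i\in\Omega^C_i$ for all $i$, and for $i\ne j$ either $\Omega^C_i\subsetneq\Omega^C_j$ or $\Omega^C_j\subsetneq\Omega^C_i$, where $\Omega^C_i\subsetneq\Omega^C_j$ implies $j\notin\Omega^C_i$. The arm is PCL-indexable w.r.t. $\tilde\Omega$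 if PCL holds w.r.t. $\tilde\Omega$ and there is exactly one full subset chain $C$ of $\tilde\Omega$ such that the numbers $\lambda_i=W_i^{\Omega^C_i}/A_i^{\Omega^C_i}$ are well defined (nonzero denominators) and $\Omega^C_i\subsetneq\Omega^C_j$ implies $\lambda_i<\lambda_j$. An RMAB, i.e. a finite collection of such arms, each with its own $\omega_0$ and $\tilde\Omega$, is PCL-indexable if each of its arms is. **Whittle index.** The passive set $\mathcal P(\lambda)$ of an arm consists of the states $i\in S$ from which some optimal policy of the problem with subsidy $\lambda$ starts with the passive action. The arm is Whittle indexable if $\mathcal P(\lambda)$ is nondecreasing in $\lambda$, empty for all sufficiently small $\lambda$ and equal to $S$ for all sufficiently large $\lambda$; the Whittle index of $i$ is then $\inf\{\lambda:i\in\mathcal P(\lambda)\}$. An RMAB is Whittle indexable if each of its arms is. **Theorem 3.** Suppose that the RMAB is PCL-indexable and that for each arm the family $(\lambda_i)_{i\in S}$ has only finitely many limit points in $\mathbb R$. Then for each arm: 1. for every subsidy $\lambda$, every priority policy given by the indices $(\lambda_i)_{i\in S}$ and the index $\lambda$ of the auxiliary state (activate the original arm in states with $\lambda_i>\lambda$,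 the auxiliary arm in states with $\lambda_i<\lambda$, break ties arbitrarily) is optimal for the two-arm problem from every initial state in $S$; 2. the arm is Whittle indexable (hence so is the RMAB), and $\lambda_i$ is the Whittle index of the belief state $i$, for every $i\in S$. -/

import Mathlib

open scoped Matrix

/-- A matrix with nonnegative entries all of whose rows sum to one. -/
def IsStochastic {m n : ℕ} (A : Matrix (Fin m) (Fin n) ℝ) : Prop :=
  (∀ i j, 0 ≤ A i j) ∧ ∀ i, ∑ j, A i j = 1

/-- The belief simplex over `M` true states. -/
abbrev Belief (M : ℕ) : Type := stdSimplex ℝ (Fin M)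

/-- A partially observable arm with `M` true states and `L` feedback states. -/
structure POArm (M L : ℕ) where
  /-- transition matrix of the true state -/
  P : Matrix (Fin M) (Fin M) ℝ
  /-- `E i j` is the probability of observing `j` when the true state is `i` -/
  E : Matrix (Fin M) (Fin M) ℝ
  /-- `r i j` is the reward when the true state is `i` and the observed state is `j` -/
  r : Matrix (Fin M) (Fin M) ℝ
  /-- `ρ i l` is the probability of the feedback `l` when the true state is `i` -/
  ρ : Matrix (Fin M) (Fin L) ℝ
  stochastic_P : IsStochastic P
  stochastic_E : IsStochastic E
  stochastic_ρ : IsStochastic ρ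

noncomputable section

namespace POArm

variable {M L : ℕ} (X : POArm M L)

/-- Expected immediate reward of the active action at belief `ω`. -/
def reward (ω : Belief M) : ℝ := ∑ i, ω.1 i * ∑ j, X.E i j * X.r i j

/-- Probability of the feedback `l` when the arm is activated at belief `ω`. -/
def feedbackProb (ω : Belief M) (l : Fin L) : ℝ := ∑ k, X.ρ k l * ω.1 k

theorem feedbackProb_nonneg (ω : Belief M) (l : Fin L) : 0 ≤ X.feedbackProb ω l :=
  Finset.sum_nonneg fun k _ => mul_nonneg (X.stochastic_ρ.1 k l) (ω.2.1 k)

theorem sum_feedbackProb (ω : Belief M) : ∑ l, X.feedbackProb ω l = 1 := by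
  unfold feedbackProb
  rw [Finset.sum_comm]
  simp_rw [← Finset.sum_mul, X.stochastic_ρ.2, one_mul]
  exact ω.2.2

/-- Belief update under the passive action: `ω ↦ ω P`. -/
def passiveUpdate (ω : Belief M) : Belief M :=
  ⟨ω.1 ᵥ* X.P, by
    simp only [stdSimplex, Set.mem_ofPred_eq, Matrix.vecMul, dotProduct]
    refine ⟨fun j => Finset.sum_nonneg fun k _ => mul_nonneg (ω.2.1 k) (X.stochastic_P.1 k j), ?_⟩
    rw [Finset.sum_comm]
    simp_rw [← Finset.mul_sum, X.stochastic_P.2, mul_one]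
    exact ω.2.2⟩

open Classical in
/-- Belief update under the active action with feedback `l`, by Bayes' rule. When the feedback `l`
has probability zero, so that it never occurs, the value is by convention `ω P`; in this way such
feedbacks create no new belief states. -/
def activeUpdate (l : Fin L) (ω : Belief M) : Belief M :=
  if h : X.feedbackProb ω l = 0 then X.passiveUpdate ω
  else ⟨fun j => (∑ k, X.P k j * X.ρ k l * ω.1 k) / X.feedbackProb ω l, by
    refine ⟨fun j => div_nonneg (Finset.sum_nonneg fun k _ =>
      mul_nonneg (mul_nonneg (X.stochastic_P.1 k j) (X.stochastic_ρ.1 k l)) (ω.2.1 k))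
      (X.feedbackProb_nonneg ω l), ?_⟩
    rw [← Finset.sum_div, Finset.sum_comm]
    simp_rw [← Finset.sum_mul, X.stochastic_P.2, one_mul]
    exact div_self h⟩

/-- The update operators: `none` is the passive one, `some l` the active one with feedback `l`. -/
def update : Option (Fin L) → Belief M → Belief M
  | none => X.passiveUpdate
  | some l => X.activeUpdate l

/-- The belief state space generated by `ω₀`: all beliefs obtained from `ω₀` by finitely many
updates. -/
def beliefSpace (ω₀ : Belief M) : Set (Belief M) :=
  {ω | ∃ w : List (Option (Fin L)), w.foldr X.update ω₀ = ω}

/-- The states of the belief process started in `ω₀`. -/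
abbrev State (ω₀ : Belief M) : Type := X.beliefSpace ω₀

variable {ω₀ : Belief M}

/-- The update operators act on the belief state space. -/
def stateUpdate (o : Option (Fin L)) (s : X.State ω₀) : X.State ω₀ :=
  ⟨X.update o s.1, by
    obtain ⟨w, hw⟩ := s.2
    exact ⟨o :: w, by rw [List.foldr_cons, hw]⟩⟩

/-- The law of the feedback when the arm is activated at belief `ω`. -/
def feedbackLaw (ω : Belief M) : PMF (Fin L) :=
  PMF.ofFintype (fun l => ENNReal.ofReal (X.feedbackProb ω l)) (by
    rw [← ENNReal.ofReal_sum_of_nonneg fun l _ => X.feedbackProb_nonneg ω l,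
      X.sum_feedbackProb, ENNReal.ofReal_one])

/-- Law of the next belief state; the action `true` is active, `false` is passive. -/
def trans : Bool → X.State ω₀ → PMF (X.State ω₀)
  | true, s => (X.feedbackLaw s.1).map fun l => X.stateUpdate (some l) s
  | false, s => PMF.pure (X.stateUpdate none s)

/-- Transition probabilities of the belief state under the two actions. -/
def p (a : Bool) (i j : X.State ω₀) : ℝ := (X.trans a i j).toReal

/-- An admissible policy of the two-arm system: given the past belief states and actions (most
recent first) and the current belief state of the original arm, it chooses, possibly at random,
whether the original arm (`true`) or the auxiliary arm (`false`) is activated. -/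
abbrev Policy (ω₀ : Belief M) : Type := List (X.State ω₀ × Bool) → X.State ω₀ → PMF Bool

/-- Joint law of the past before time `t` and of the belief state at time `t`, under the policy `π`
and from the initial state `i`. -/
def historyLaw (π : X.Policy ω₀) (i : X.State ω₀) :
    ℕ → PMF (List (X.State ω₀ × Bool) × X.State ω₀)
  | 0 => PMF.pure ([], i)
  | t + 1 => (historyLaw π i t).bind fun z => (π z.1 z.2).bind fun a =>
      (X.trans a z.2).map fun s => ((z.2, a) :: z.1, s)

/-- Law of the belief state and the action at time `t`. -/
def stateActionLaw (π : X.Policy ω₀) (i : X.State ω₀) (t : ℕ) : PMF (X.State ω₀ × Bool) :=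
  (X.historyLaw π i t).bind fun z => (π z.1 z.2).map fun a => (z.2, a)

/-- `E_π[∑ₜ βᵗ f(ω(t), a(t)) | ω(0) = i]`, for bounded `f`. -/
def discounted (β : ℝ) (π : X.Policy ω₀) (i : X.State ω₀) (f : X.State ω₀ × Bool → ℝ) : ℝ :=
  ∑' t : ℕ, β ^ t * ∑' z, (X.stateActionLaw π i t z).toReal * f z

open Classical in
/-- The performance measure `x_ω^a(π, i)` of the belief state `ω`. -/
def x (β : ℝ) (a : Bool) (ω : X.State ω₀) (π : X.Policy ω₀) (i : X.State ω₀) : ℝ :=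
  X.discounted β π i fun z => if z = (ω, a) then 1 else 0

/-- The performance measure `x_0^1(π, i)` of the auxiliary arm, which is activated exactly when the
original arm is passive. -/
def xAux (β : ℝ) (π : X.Policy ω₀) (i : X.State ω₀) : ℝ :=
  X.discounted β π i fun z => if z.2 = false then 1 else 0

/-- Expected total discounted time during which the original arm is active. -/
def activeTime (β : ℝ) (π : X.Policy ω₀) (i : X.State ω₀) : ℝ :=
  X.discounted β π i fun z => if z.2 = true then 1 else 0

/-- Expected total discounted reward from the original arm. -/
def armReward (β : ℝ) (π : X.Policy ω₀) (i : X.State ω₀) : ℝ :=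
  X.discounted β π i fun z => if z.2 = true then X.reward z.1 else 0

/-- Expected total discounted reward of the two-arm problem: the auxiliary arm pays the subsidy
`lam` whenever it is activated, that is, whenever the original arm is passive. -/
def value (β lam : ℝ) (π : X.Policy ω₀) (i : X.State ω₀) : ℝ :=
  X.discounted β π i fun z => if z.2 = true then X.reward z.1 else lam

open Classical in
/-- The `Ω`-priority policy: the original arm is active exactly in the states of `Ω`. -/
def priorityPolicy (Ω : Set (X.State ω₀)) : X.Policy ω₀ := fun _ s => PMF.pure (decide (s ∈ Ω))

/-- The coefficient `A_i^Ω`. -/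
def coeffA (β : ℝ) (Ω : Set (X.State ω₀)) (i : X.State ω₀) : ℝ :=
  1 + β * ∑' j, (X.p true i j - X.p false i j) * X.activeTime β (X.priorityPolicy Ωᶜ) j

/-- The coefficient `W_i^Ω`. -/
def coeffW (β : ℝ) (Ω : Set (X.State ω₀)) (i : X.State ω₀) : ℝ :=
  X.reward i.1 +
    β * ∑' j, (X.p true i j - X.p false i j) * X.armReward β (X.priorityPolicy Ωᶜ) j

/-- `∑_{ω ∈ Ω} A_ω^Ω x_ω^1(π, i)`. -/
def weightedSum (β : ℝ) (Ω : Set (X.State ω₀)) (π : X.Policy ω₀) (i : X.State ω₀) : ℝ :=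
  ∑' ω : Ω, X.coeffA β Ω ω * X.x β true ω.1 π i

/-- `b(Ω)`, for the initial state `i`. -/
def bound (β : ℝ) (Ω : Set (X.State ω₀)) (i : X.State ω₀) : ℝ :=
  ⨅ π : X.Policy ω₀, X.weightedSum β Ω π i

/-- `b({0} ∪ Ω)`, for the initial state `i`. -/
def boundAux (β : ℝ) (Ω : Set (X.State ω₀)) (i : X.State ω₀) : ℝ :=
  ⨅ π : X.Policy ω₀, (X.xAux β π i + X.weightedSum β Ω π i)

/-- The policy gives priority to the states of `Ω` over the auxiliary state. -/
def PriorityOverAux (π : X.Policy ω₀) (Ω : Set (X.State ω₀)) : Prop :=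
  ∀ h, ∀ s ∈ Ω, π h s = PMF.pure true

/-- The policy gives priority to the auxiliary state over the states of `Ω`. -/
def AuxPriorityOver (π : X.Policy ω₀) (Ω : Set (X.State ω₀)) : Prop :=
  ∀ h, ∀ s ∈ Ω, π h s = PMF.pure false

/-- The partial conservation law with respect to the family `F` of sets of belief states. -/
structure PartialConservationLaw (β : ℝ) (F : Set (Set (X.State ω₀))) : Prop where
  le_aux : ∀ Ω ∈ F, ∀ π i, X.boundAux β Ω i ≤ X.xAux β π i + X.weightedSum β Ω π i
  le : ∀ Ω ∈ F, ∀ π i, X.bound β Ω i ≤ X.weightedSum β Ω π i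
  total : ∀ (π : X.Policy ω₀) (i : X.State ω₀), X.xAux β π i + ∑' ω, X.x β true ω π i =
    X.boundAux β Set.univ i
  eq_aux : ∀ Ω ∈ F, ∀ π i, X.PriorityOverAux π Ωᶜ →
    X.xAux β π i + X.weightedSum β Ω π i = X.boundAux β Ω i
  eq : ∀ Ω ∈ F, ∀ π i, X.AuxPriorityOver π Ω → X.weightedSum β Ω π i = X.bound β Ω i

/-- `C` is a full subset chain of `F`. -/
structure IsFullSubsetChain (F : Set (Set (X.State ω₀))) (C : X.State ω₀ → Set (X.State ω₀)) :
    Prop where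
  mem_family : ∀ i, C i ∈ F
  self_mem : ∀ i, i ∈ C i
  total : ∀ i j, i ≠ j → C i ⊂ C j ∨ C j ⊂ C i
  not_mem : ∀ i j, i ≠ j → C i ⊂ C j → j ∉ C i

/-- The index `λ_i^C = W_i / A_i`, both coefficients being taken for the set `C i`. -/
def chainIndex (β : ℝ) (C : X.State ω₀ → Set (X.State ω₀)) (i : X.State ω₀) : ℝ :=
  X.coeffW β (C i) i / X.coeffA β (C i) i

/-- `C` is a full subset chain of `F` whose indices are well defined and strictly increase along
the chain. -/
structure IsIndexChain (β : ℝ) (F : Set (Set (X.State ω₀))) (C : X.State ω₀ → Set (X.State ω₀)) :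
    Prop where
  chain : X.IsFullSubsetChain F C
  denom_ne_zero : ∀ i, X.coeffA β (C i) i ≠ 0
  strict : ∀ i j, i ≠ j → C i ⊂ C j → X.chainIndex β C i < X.chainIndex β C j

/-- PCL-indexability with respect to the family `F`, which contains the whole state space. -/
structure PCLIndexable (β : ℝ) (F : Set (Set (X.State ω₀))) : Prop where
  univ_mem : Set.univ ∈ F
  pcl : X.PartialConservationLaw β F
  existsUnique_chain : ∃! C : X.State ω₀ → Set (X.State ω₀), X.IsIndexChain β F C

/-- The family of reals `idx` has only finitely many limit points; a limit point is a real each of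
whose neighbourhoods contains `idx i` for infinitely many `i`. -/
def FinitelyManyLimitPoints {ι : Type*} (idx : ι → ℝ) : Prop :=
  {v : ℝ | MapClusterPt v Filter.cofinite idx}.Finite

/-- `π` maximizes the expected total discounted reward of the two-arm problem from `i`. -/
def IsOptimalFrom (β lam : ℝ) (π : X.Policy ω₀) (i : X.State ω₀) : Prop :=
  ∀ π' : X.Policy ω₀, X.value β lam π' i ≤ X.value β lam π i

/-- `π` is a priority policy for the index `idx` in the two-arm problem, the auxiliary state having
the index `lam`: the arm whose state has the larger index is activated (ties are broken
arbitrarily). -/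
def IsIndexPriorityPolicy (idx : X.State ω₀ → ℝ) (lam : ℝ) (π : X.Policy ω₀) : Prop :=
  X.PriorityOverAux π {s | lam < idx s} ∧ X.AuxPriorityOver π {s | idx s < lam}

/-- The passive set: the states in which being passive is an optimal choice under the subsidy
`lam`. -/
def passiveSet (β : ℝ) (ω₀ : Belief M) (lam : ℝ) : Set (X.State ω₀) :=
  {i | ∃ π : X.Policy ω₀, π [] i = PMF.pure false ∧ X.IsOptimalFrom β lam π i}

/-- Whittle indexability of the arm: the passive set increases from the empty set to the whole state
space as the subsidy increases from `-∞` to `+∞`. -/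
structure WhittleIndexable (β : ℝ) (ω₀ : Belief M) : Prop where
  mono : Monotone (X.passiveSet β ω₀)
  eventually_empty : ∀ᶠ lam in Filter.atBot, X.passiveSet β ω₀ lam = ∅
  eventually_univ : ∀ᶠ lam in Filter.atTop, X.passiveSet β ω₀ lam = Set.univ

/-- `w` is the Whittle index of the state `i`: the infimum of the subsidies for which `i` lies in
the passive set. -/
def IsWhittleIndex (β : ℝ) (i : X.State ω₀) (w : ℝ) : Prop :=
  IsGLB {lam : ℝ | i ∈ X.passiveSet β ω₀ lam} w

end POArm

/-- A restless bandit is Whittle indexable if each of its decoupled single-arm problems is. -/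
def RMABWhittleIndexable {N : ℕ} {M L : Fin N → ℕ} (arm : ∀ n, POArm (M n) (L n)) (β : ℝ)
    (ω₀ : ∀ n, Belief (M n)) : Prop :=
  ∀ n, (arm n).WhittleIndexable β (ω₀ n)

end

/-!
By the performance difference lemma, a policy earns as much as the `D`-priority policy plus the
discounted sum of the advantages `advantage β D c s` over the slots in which it deviates from `D`.
For the active time as reward, the advantage with respect to `Ωᶜ` is `A^Ω`, and the conservation law
forces `A^Ω ≥ 0` for all `Ω ∈ F`.

For the subsidized reward and `D = {j | λ < λ_j}`, the advantage in the state `i` is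
`g_i(λ) = W_i - λ A_i`, with coefficients depending on `λ` through `D`, and everything follows once
`g_i` is known to be positive to the left of `λ_i` and nonpositive from `λ_i` on. By the definition
of the index, `g_i(λ_i) = 0`. When `λ` crosses an index, only a state of zero advantage leaves `D`,
so `g_i` is continuous. To the right of a value that is not a limit point of the index, `D` is
locally constant and `g_i` is affine of slope `-A_i ≤ 0`. A continuous function which is
nonincreasing immediately to the right of all but countably many points is nonincreasing, so the
limit points do no harm; strict positivity comes from `A_i > 0` immediately to the left of `λ_i`.
-/

noncomputable section

open Filter Topology
open scoped ENNReal

section Bounded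

variable {α γ : Type*} {f g : α → ℝ}

theorem memℓp_infty_of_abs_le {B : ℝ} (hB : ∀ z, |f z| ≤ B) : Memℓp f ∞ :=
  memℓp_infty ⟨B, Set.forall_mem_range.2 hB⟩

theorem exists_abs_le_of_memℓp_infty (hf : Memℓp f ∞) : ∃ B, ∀ z, |f z| ≤ B :=
  hf.bddAbove.imp fun _ hB => Set.forall_mem_range.1 hB

theorem memℓp_infty_const (c : ℝ) : Memℓp (fun _ : α => c) ∞ :=
  memℓp_infty_of_abs_le fun _ => le_rfl

theorem memℓp_infty_comp (hf : Memℓp f ∞) (e : γ → α) : Memℓp (fun z => f (e z)) ∞ :=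
  memℓp_infty (hf.bddAbove.mono (Set.range_comp_subset_range e fun z => ‖f z‖))

theorem memℓp_infty_ite (hf : Memℓp f ∞) (hg : Memℓp g ∞) (P : α → Prop) [DecidablePred P] :
    Memℓp (fun z => if P z then f z else g z) ∞ := by
  obtain ⟨B, hB⟩ := exists_abs_le_of_memℓp_infty hf
  obtain ⟨B', hB'⟩ := exists_abs_le_of_memℓp_infty hg
  refine memℓp_infty_of_abs_le (B := max B B') fun z => ?_
  split_ifs
  · exact (hB z).trans (le_max_left _ _)
  · exact (hB' z).trans (le_max_right _ _)

theorem memℓp_infty_indicator (hf : Memℓp f ∞) (D : Set α) : Memℓp (D.indicator f) ∞ := by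
  classical
  exact memℓp_infty_ite hf (memℓp_infty_const 0) (· ∈ D)

end Bounded

section Expectation

variable {α γ : Type*} (μ : PMF α) {f g : α → ℝ}

/-- The expectation of a real function under a discrete probability law, which is meaningful for
bounded functions. -/
def expectation (μ : PMF α) (f : α → ℝ) : ℝ := ∑' z, (μ z).toReal * f z

theorem summable_pmf_toReal : Summable fun z => (μ z).toReal :=
  ENNReal.summable_toReal μ.tsum_coe_ne_top

theorem norm_toReal_mul_le {B : ℝ} (hB : ∀ z, |f z| ≤ B) (z : α) :
    ‖(μ z).toReal * f z‖ ≤ (μ z).toReal * B := by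
  rw [Real.norm_eq_abs, abs_mul, abs_of_nonneg ENNReal.toReal_nonneg]
  exact mul_le_mul_of_nonneg_left (hB z) ENNReal.toReal_nonneg

theorem summable_toReal_mul (hf : Memℓp f ∞) : Summable fun z => (μ z).toReal * f z := by
  obtain ⟨B, hB⟩ := exists_abs_le_of_memℓp_infty hf
  exact .of_norm_bounded ((summable_pmf_toReal μ).mul_right B) (norm_toReal_mul_le μ hB)

theorem expectation_mono (hf : Memℓp f ∞) (hg : Memℓp g ∞) (h : ∀ z ∈ μ.support, f z ≤ g z) :
    expectation μ f ≤ expectation μ g := by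
  refine (summable_toReal_mul μ hf).tsum_le_tsum (fun z => ?_) (summable_toReal_mul μ hg)
  by_cases hz : z ∈ μ.support
  · exact mul_le_mul_of_nonneg_left (h z hz) ENNReal.toReal_nonneg
  · simp [(μ.apply_eq_zero_iff z).2 hz]

theorem expectation_congr (h : ∀ z ∈ μ.support, f z = g z) :
    expectation μ f = expectation μ g := by
  refine tsum_congr fun z => ?_
  by_cases hz : z ∈ μ.support
  · rw [h z hz]
  · simp [(μ.apply_eq_zero_iff z).2 hz]

theorem expectation_const (c : ℝ) : expectation μ (fun _ => c) = c := by
  rw [expectation, tsum_mul_right, ← ENNReal.tsum_toReal_eq μ.apply_ne_top, μ.tsum_coe,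
    ENNReal.toReal_one, one_mul]

theorem expectation_add (hf : Memℓp f ∞) (hg : Memℓp g ∞) :
    expectation μ (fun z => f z + g z) = expectation μ f + expectation μ g := by
  simp only [expectation, mul_add]
  exact (summable_toReal_mul μ hf).tsum_add (summable_toReal_mul μ hg)

theorem expectation_const_mul (c : ℝ) (f : α → ℝ) :
    expectation μ (fun z => c * f z) = c * expectation μ f := by
  simp only [expectation, mul_left_comm _ c, tsum_mul_left]

theorem expectation_sub (hf : Memℓp f ∞) (hg : Memℓp g ∞) :
    expectation μ (fun z => f z - g z) = expectation μ f - expectation μ g := by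
  simp only [expectation, mul_sub]
  exact (summable_toReal_mul μ hf).tsum_sub (summable_toReal_mul μ hg)

theorem abs_expectation_le {B : ℝ} (hB : ∀ z, |f z| ≤ B) : |expectation μ f| ≤ B := by
  rw [← expectation_const μ B]
  exact tsum_of_norm_bounded ((summable_toReal_mul μ (memℓp_infty_const B)).hasSum)
    (norm_toReal_mul_le μ hB)

theorem expectation_pure (a : α) (f : α → ℝ) : expectation (PMF.pure a) f = f a := by
  rw [expectation_congr (g := fun _ => f a) _ fun z hz => by
    rw [(PMF.mem_support_pure_iff _ _).1 hz], expectation_const]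

theorem expectation_bind (κ : α → PMF γ) {f : γ → ℝ} (hf : Memℓp f ∞) :
    expectation (μ.bind κ) f = expectation μ fun a => expectation (κ a) f := by
  obtain ⟨B, hB⟩ := exists_abs_le_of_memℓp_infty hf
  have hmass : Summable fun q : α × γ => (μ q.1 * κ q.1 q.2).toReal := by
    refine ENNReal.summable_toReal ?_
    rw [ENNReal.tsum_prod (f := fun a b => μ a * κ a b)]
    simp only [ENNReal.tsum_mul_left, PMF.tsum_coe, mul_one, ne_eq, ENNReal.one_ne_top,
      not_false_eq_true]
  have hjoint : Summable (Function.uncurry fun a b => (μ a * κ a b).toReal * f b) := by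
    refine .of_norm_bounded (hmass.mul_right B) fun q => ?_
    rw [Function.uncurry, Real.norm_eq_abs, abs_mul, abs_of_nonneg ENNReal.toReal_nonneg]
    exact mul_le_mul_of_nonneg_left (hB q.2) ENNReal.toReal_nonneg
  calc expectation (μ.bind κ) f = ∑' b, ∑' a, (μ a * κ a b).toReal * f b := by
        refine tsum_congr fun b => ?_
        rw [PMF.bind_apply, tsum_mul_right, ENNReal.tsum_toReal_eq fun a =>
          ENNReal.mul_ne_top (μ.apply_ne_top a) ((κ a).apply_ne_top b)]
    _ = ∑' a, ∑' b, (μ a * κ a b).toReal * f b := hjoint.tsum_comm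
    _ = expectation μ fun a => expectation (κ a) f := by
        simp only [expectation, ENNReal.toReal_mul, mul_assoc, tsum_mul_left]

theorem expectation_map (e : α → γ) {f : γ → ℝ} (hf : Memℓp f ∞) :
    expectation (μ.map e) f = expectation μ fun a => f (e a) := by
  simp only [PMF.map, expectation_bind _ _ hf, Function.comp_apply, expectation_pure]

theorem expectation_le_toReal_mul (hf : Memℓp f ∞) (h : ∀ z ∈ μ.support, f z ≤ 0) (a : α) :
    expectation μ f ≤ (μ a).toReal * f a := by
  have hle : expectation μ f ≤ expectation μ (({a} : Set α).indicator f) :=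
    expectation_mono μ hf (memℓp_infty_indicator hf _) fun z hz =>
      Set.le_indicator_apply (fun _ => le_rfl) fun _ => h z hz
  refine hle.trans_eq ((tsum_eq_single a fun z hz => ?_).trans ?_)
  · rw [Set.indicator_of_notMem (Set.notMem_singleton_iff.2 hz), mul_zero]
  · rw [Set.indicator_of_mem (Set.mem_singleton a)]

theorem tendsto_expectation {κ : Type*} {l : Filter κ} {u : κ → α → ℝ} {B : ℝ}
    (hB : ∀ n z, |u n z| ≤ B) (h : ∀ z, Tendsto (fun n => u n z) l (𝓝 (f z))) :
    Tendsto (fun n => expectation μ (u n)) l (𝓝 (expectation μ f)) :=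
  tendsto_tsum_of_dominated_convergence ((summable_pmf_toReal μ).mul_right B)
    (fun z => (h z).const_mul _) (.of_forall fun n => norm_toReal_mul_le μ (hB n))

end Expectation

/-- The discounted evaluation operator is a contraction of the space of bounded functions. -/
theorem exists_memℓp_eq_add_mul_expectation {S : Type*} {β : ℝ} (hβ : β ∈ Set.Ico (0 : ℝ) 1)
    (κ : S → PMF S) {c : S → ℝ} (hc : Memℓp c ∞) :
    ∃ h : S → ℝ, Memℓp h ∞ ∧ ∀ s, h s = c s + β * expectation (κ s) h := by
  have hT (h : lp (fun _ : S => ℝ) ∞) : Memℓp (fun s => c s + β * expectation (κ s) h) ∞ :=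
    hc.add <| Memℓp.const_mul (memℓp_infty_of_abs_le fun s =>
      abs_expectation_le (κ s) (lp.norm_apply_le_norm ENNReal.top_ne_zero h)) β
  let T (h : lp (fun _ : S => ℝ) ∞) : lp (fun _ : S => ℝ) ∞ := ⟨_, hT h⟩
  have hcontr : ContractingWith ⟨β, hβ.1⟩ T := by
    refine ⟨hβ.2, LipschitzWith.of_dist_le_mul fun h h' => ?_⟩
    rw [dist_eq_norm, dist_eq_norm]
    refine lp.norm_le_of_forall_le (mul_nonneg hβ.1 (norm_nonneg _)) fun s => ?_
    have hsub : (T h - T h') s = β * expectation (κ s) fun j => h j - h' j := by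
      rw [expectation_sub _ (lp.memℓp h) (lp.memℓp h')]
      change c s + _ - (c s + _) = _
      ring
    rw [hsub, Real.norm_eq_abs, abs_mul, abs_of_nonneg hβ.1]
    exact mul_le_mul_of_nonneg_left (abs_expectation_le _
      (lp.norm_apply_le_norm ENNReal.top_ne_zero (h - h'))) hβ.1
  refine ⟨hcontr.fixedPoint, lp.memℓp _, fun s => ?_⟩
  exact congrFun (congrArg Subtype.val hcontr.fixedPoint_isFixedPt.symm) s

section Discounting

variable {β : ℝ} (hβ : β ∈ Set.Ico (0 : ℝ) 1)

/-- The geometric law giving the slot `t` a probability proportional to its discount factor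
`β ^ t`. -/
def discountLaw (hβ : β ∈ Set.Ico (0 : ℝ) 1) : PMF ℕ :=
  (ProbabilityTheory.geometricMeasure ⟨1 - β, sub_nonneg.2 hβ.2.le, sub_le_self 1 hβ.1⟩).toPMF

theorem toReal_discountLaw (t : ℕ) : (discountLaw hβ t).toReal = (1 - β) * β ^ t := by
  have hne : (⟨1 - β, sub_nonneg.2 hβ.2.le, sub_le_self 1 hβ.1⟩ : unitInterval) ≠ 0 :=
    fun h => (sub_pos.2 hβ.2).ne' (congrArg Subtype.val h)
  have h := ProbabilityTheory.geometricMeasure_real_singleton hne t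
  rwa [sub_sub_cancel, mul_comm] at h

theorem tsum_pow_mul_eq_expectation (f : ℕ → ℝ) :
    ∑' t, β ^ t * f t = (1 - β)⁻¹ * expectation (discountLaw hβ) f := by
  simp only [expectation, toReal_discountLaw, mul_assoc, tsum_mul_left]
  exact (inv_mul_cancel_left₀ (sub_pos.2 hβ.2).ne' _).symm

end Discounting

namespace POArm

variable {M L : ℕ} {X : POArm M L} {ω₀ : Belief M} {β : ℝ}

/-- The expected value of `h` at the state that follows `s` under the action `a`. -/
def nextValue (X : POArm M L) {ω₀ : Belief M} (a : Bool) (h : X.State ω₀ → ℝ) (s : X.State ω₀) :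
    ℝ :=
  expectation (X.trans a s) h

theorem memℓp_nextValue {h : X.State ω₀ → ℝ} (hh : Memℓp h ∞) :
    Memℓp (fun z : X.State ω₀ × Bool => X.nextValue z.2 h z.1) ∞ :=
  (exists_abs_le_of_memℓp_infty hh).elim fun _ hB =>
    memℓp_infty_of_abs_le fun _ => abs_expectation_le _ hB

theorem tsum_p_sub_p_mul {h : X.State ω₀ → ℝ} (hh : Memℓp h ∞) (s : X.State ω₀) :
    ∑' j, (X.p true s j - X.p false s j) * h j =
      X.nextValue true h s - X.nextValue false h s := by
  simp only [sub_mul]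
  exact (summable_toReal_mul _ hh).tsum_sub (summable_toReal_mul _ hh)

section Occupation

variable {π : X.Policy ω₀} {i : X.State ω₀} {f g : X.State ω₀ × Bool → ℝ}

theorem expectation_stateActionLaw (t : ℕ) (hf : Memℓp f ∞) :
    expectation (X.stateActionLaw π i t) f = expectation (X.historyLaw π i t) fun y =>
      expectation (π y.1 y.2) fun a => f (y.2, a) := by
  simp only [stateActionLaw, expectation_bind _ _ hf, expectation_map _ _ hf]

theorem expectation_historyLaw_succ (t : ℕ) {h : X.State ω₀ → ℝ} (hh : Memℓp h ∞) :
    expectation (X.historyLaw π i (t + 1)) (fun y => h y.2) =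
      expectation (X.stateActionLaw π i t) fun z => X.nextValue z.2 h z.1 := by
  have hsnd : Memℓp (fun y : List (X.State ω₀ × Bool) × X.State ω₀ => h y.2) ∞ :=
    memℓp_infty_comp hh Prod.snd
  rw [expectation_stateActionLaw t (memℓp_nextValue hh)]
  simp only [historyLaw, expectation_bind _ _ hsnd, expectation_map _ _ hsnd]
  rfl

theorem expectation_stateActionLaw_fst (t : ℕ) {h : X.State ω₀ → ℝ} (hh : Memℓp h ∞) :
    expectation (X.stateActionLaw π i t) (fun z => h z.1) =
      expectation (X.historyLaw π i t) fun y => h y.2 := by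
  simp only [expectation_stateActionLaw t (memℓp_infty_comp hh Prod.fst), expectation_const]

/-- The law of the state and action in a random slot drawn from `discountLaw hβ`; expected total
discounted rewards are `(1 - β)⁻¹` times expectations under it. -/
def occupationLaw (hβ : β ∈ Set.Ico (0 : ℝ) 1) (π : X.Policy ω₀) (i : X.State ω₀) :
    PMF (X.State ω₀ × Bool) :=
  (discountLaw hβ).bind (X.stateActionLaw π i)

theorem exists_mem_support_of_mem_support_stateActionLaw {t : ℕ} {z : X.State ω₀ × Bool}
    (hz : z ∈ (X.stateActionLaw π i t).support) : ∃ past, z.2 ∈ (π past z.1).support := by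
  obtain ⟨y, -, hy⟩ := (PMF.mem_support_bind_iff _ _ _).1 hz
  obtain ⟨a, ha, rfl⟩ := (PMF.mem_support_map_iff _ _ _).1 hy
  exact ⟨y.1, ha⟩

theorem exists_mem_support_of_mem_support_occupationLaw (hβ : β ∈ Set.Ico (0 : ℝ) 1)
    {z : X.State ω₀ × Bool} (hz : z ∈ (occupationLaw hβ π i).support) :
    ∃ past, z.2 ∈ (π past z.1).support := by
  obtain ⟨t, -, ht⟩ := (PMF.mem_support_bind_iff _ _ _).1 hz
  exact exists_mem_support_of_mem_support_stateActionLaw ht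

theorem discounted_eq_expectation_discountLaw (hβ : β ∈ Set.Ico (0 : ℝ) 1) : X.discounted β π i f =
    (1 - β)⁻¹ * expectation (discountLaw hβ) fun t => expectation (X.stateActionLaw π i t) f :=
  tsum_pow_mul_eq_expectation hβ _

theorem discounted_eq_expectation (hβ : β ∈ Set.Ico (0 : ℝ) 1) (hf : Memℓp f ∞) :
    X.discounted β π i f = (1 - β)⁻¹ * expectation (occupationLaw hβ π i) f := by
  rw [discounted_eq_expectation_discountLaw hβ, occupationLaw, expectation_bind _ _ hf]

theorem discounted_mono (hβ : β ∈ Set.Ico (0 : ℝ) 1) (hf : Memℓp f ∞) (hg : Memℓp g ∞)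
    (h : ∀ past s, ∀ a ∈ (π past s).support, f (s, a) ≤ g (s, a)) :
    X.discounted β π i f ≤ X.discounted β π i g := by
  rw [discounted_eq_expectation hβ hf, discounted_eq_expectation hβ hg]
  refine mul_le_mul_of_nonneg_left (expectation_mono _ hf hg fun z hz => ?_)
    (inv_nonneg.2 (sub_nonneg.2 hβ.2.le))
  obtain ⟨past, ha⟩ := exists_mem_support_of_mem_support_occupationLaw hβ hz
  exact h past z.1 z.2 ha

theorem discounted_congr (h : ∀ past s, ∀ a ∈ (π past s).support, f (s, a) = g (s, a)) :
    X.discounted β π i f = X.discounted β π i g := by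
  refine tsum_congr fun t => congrArg _ (expectation_congr _ fun z hz => ?_)
  obtain ⟨past, ha⟩ := exists_mem_support_of_mem_support_stateActionLaw hz
  exact h past z.1 z.2 ha

theorem discounted_const (hβ : β ∈ Set.Ico (0 : ℝ) 1) (c : ℝ) :
    X.discounted β π i (fun _ => c) = (1 - β)⁻¹ * c := by
  rw [discounted_eq_expectation hβ (memℓp_infty_const c), expectation_const]

theorem discounted_eq_zero (hβ : β ∈ Set.Ico (0 : ℝ) 1)
    (h : ∀ past s, ∀ a ∈ (π past s).support, f (s, a) = 0) : X.discounted β π i f = 0 := by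
  rw [discounted_congr (g := fun _ => 0) h, discounted_const hβ, mul_zero]

theorem discounted_add (hβ : β ∈ Set.Ico (0 : ℝ) 1) (hf : Memℓp f ∞) (hg : Memℓp g ∞) :
    X.discounted β π i (fun z => f z + g z) = X.discounted β π i f + X.discounted β π i g := by
  rw [discounted_eq_expectation (f := fun z => f z + g z) hβ (hf.add hg),
    discounted_eq_expectation hβ hf, discounted_eq_expectation hβ hg, expectation_add _ hf hg,
    mul_add]

theorem discounted_sub (hβ : β ∈ Set.Ico (0 : ℝ) 1) (hf : Memℓp f ∞) (hg : Memℓp g ∞) :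
    X.discounted β π i (fun z => f z - g z) = X.discounted β π i f - X.discounted β π i g := by
  rw [discounted_eq_expectation (f := fun z => f z - g z) hβ (hf.sub hg),
    discounted_eq_expectation hβ hf, discounted_eq_expectation hβ hg, expectation_sub _ hf hg,
    mul_sub]

theorem discounted_const_mul (c : ℝ) (f : X.State ω₀ × Bool → ℝ) :
    X.discounted β π i (fun z => c * f z) = c * X.discounted β π i f := by
  simp only [discounted, mul_left_comm _ c, tsum_mul_left]

theorem abs_discounted_le (hβ : β ∈ Set.Ico (0 : ℝ) 1) {B : ℝ} (hB : ∀ z, |f z| ≤ B) :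
    |X.discounted β π i f| ≤ (1 - β)⁻¹ * B := by
  have hnonneg : 0 ≤ (1 - β)⁻¹ := inv_nonneg.2 (sub_nonneg.2 hβ.2.le)
  rw [discounted_eq_expectation hβ (memℓp_infty_of_abs_le hB), abs_mul, abs_of_nonneg hnonneg]
  exact mul_le_mul_of_nonneg_left (abs_expectation_le _ hB) hnonneg

theorem tendsto_discounted (hβ : β ∈ Set.Ico (0 : ℝ) 1) {κ : Type*} {l : Filter κ}
    {u : κ → X.State ω₀ × Bool → ℝ} {B : ℝ} (hB : ∀ n z, |u n z| ≤ B) (hf : Memℓp f ∞)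
    (h : ∀ z, Tendsto (fun n => u n z) l (𝓝 (f z))) :
    Tendsto (fun n => X.discounted β π i (u n)) l (𝓝 (X.discounted β π i f)) := by
  simp only [discounted_eq_expectation hβ hf,
    discounted_eq_expectation hβ (memℓp_infty_of_abs_le (hB _))]
  exact (tendsto_expectation _ hB h).const_mul _

theorem discounted_le_of_nonpos (hβ : β ∈ Set.Ico (0 : ℝ) 1) (hf : Memℓp f ∞)
    (h : ∀ past s, ∀ a ∈ (π past s).support, f (s, a) ≤ 0) {a : Bool}
    (ha : π [] i = PMF.pure a) : X.discounted β π i f ≤ f (i, a) := by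
  obtain ⟨B, hB⟩ := exists_abs_le_of_memℓp_infty hf
  have hslot (t : ℕ) : expectation (X.stateActionLaw π i t) f ≤ 0 := by
    rw [← expectation_const (X.stateActionLaw π i t) 0]
    refine expectation_mono _ hf (memℓp_infty_const 0) fun z hz => ?_
    obtain ⟨past, ha⟩ := exists_mem_support_of_mem_support_stateActionLaw hz
    exact h past z.1 z.2 ha
  have hfirst : expectation (X.stateActionLaw π i 0) f = f (i, a) := by
    simp only [expectation_stateActionLaw 0 hf, historyLaw, expectation_pure, ha]
  rw [discounted_eq_expectation_discountLaw hβ, inv_mul_le_iff₀ (sub_pos.2 hβ.2), ← hfirst]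
  refine (expectation_le_toReal_mul (discountLaw hβ)
    (memℓp_infty_of_abs_le fun t => abs_expectation_le _ hB) (fun t _ => hslot t) 0).trans_eq ?_
  rw [toReal_discountLaw, pow_zero, mul_one]

theorem discounted_sub_nextValue (hβ : β ∈ Set.Ico (0 : ℝ) 1) {h : X.State ω₀ → ℝ}
    (hh : Memℓp h ∞) :
    X.discounted β π i (fun z => h z.1 - β * X.nextValue z.2 h z.1) = h i := by
  have hfst : Memℓp (fun z : X.State ω₀ × Bool => h z.1) ∞ := memℓp_infty_comp hh Prod.fst
  let v (t : ℕ) : ℝ := expectation (X.historyLaw π i t) fun y => h y.2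
  have hv : Summable fun t => β ^ t * v t := by
    obtain ⟨B, hB⟩ := exists_abs_le_of_memℓp_infty hh
    refine .of_norm_bounded ((summable_geometric_of_lt_one hβ.1 hβ.2).mul_right B) fun t => ?_
    rw [Real.norm_eq_abs, abs_mul, abs_of_nonneg (pow_nonneg hβ.1 t)]
    exact mul_le_mul_of_nonneg_left (abs_expectation_le _ fun y => hB y.2) (pow_nonneg hβ.1 t)
  have hslot (t : ℕ) : β ^ t * expectation (X.stateActionLaw π i t)
      (fun z => h z.1 - β * X.nextValue z.2 h z.1) = β ^ t * v t - β ^ (t + 1) * v (t + 1) := by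
    rw [expectation_sub _ hfst ((memℓp_nextValue hh).const_mul β), expectation_const_mul,
      expectation_stateActionLaw_fst t hh, ← expectation_historyLaw_succ t hh]
    ring
  calc X.discounted β π i _ = ∑' t, (β ^ t * v t - β ^ (t + 1) * v (t + 1)) := tsum_congr hslot
    _ = v 0 := by
        rw [hv.tsum_sub ((summable_nat_add_iff 1).2 hv), hv.tsum_eq_zero_add, add_sub_cancel_right,
          pow_zero, one_mul]
    _ = h i := expectation_pure _ _

end Occupation

section PriorityPolicy

variable {D : Set (X.State ω₀)} {c : X.State ω₀ × Bool → ℝ}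

theorem mem_support_priorityPolicy {past : List (X.State ω₀ × Bool)} {s : X.State ω₀} {a : Bool} :
    a ∈ (X.priorityPolicy D past s).support ↔ (a = true ↔ s ∈ D) := by
  classical rw [priorityPolicy, PMF.mem_support_pure_iff, Bool.eq_iff_iff, decide_eq_true_iff]

theorem memℓp_discounted (hβ : β ∈ Set.Ico (0 : ℝ) 1) (π : X.Policy ω₀) (hc : Memℓp c ∞) :
    Memℓp (fun s => X.discounted β π s c) ∞ :=
  (exists_abs_le_of_memℓp_infty hc).elim fun _ hB =>
    memℓp_infty_of_abs_le fun _ => abs_discounted_le hβ hB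

/-- The action value (or Q-function) of the `D`-priority policy: the expected total discounted
reward when the first state and action are given by `z` and the policy is followed afterwards, a
reward `c` being earned in each slot. -/
def actionValue (X : POArm M L) {ω₀ : Belief M} (β : ℝ) (D : Set (X.State ω₀))
    (c : X.State ω₀ × Bool → ℝ) (z : X.State ω₀ × Bool) : ℝ :=
  c z + β * X.nextValue z.2 (fun j => X.discounted β (X.priorityPolicy D) j c) z.1

theorem discounted_priorityPolicy_eq_actionValue (hβ : β ∈ Set.Ico (0 : ℝ) 1) (hc : Memℓp c ∞)
    {s : X.State ω₀} {a : Bool} (ha : a = true ↔ s ∈ D) :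
    X.discounted β (X.priorityPolicy D) s c = X.actionValue β D c (s, a) := by
  classical
  obtain ⟨h, hh, heq⟩ := exists_memℓp_eq_add_mul_expectation hβ
    (fun s => X.trans (decide (s ∈ D)) s) (memℓp_infty_comp hc fun s => (s, decide (s ∈ D)))
  have haction {s : X.State ω₀} {a : Bool} (ha : a = true ↔ s ∈ D) :
      h s = c (s, a) + β * X.nextValue a h s := by
    obtain rfl : a = decide (s ∈ D) := by rw [Bool.eq_iff_iff, ha, decide_eq_true_iff]
    exact heq s
  have hvalue : (fun j => X.discounted β (X.priorityPolicy D) j c) = h := by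
    funext j
    rw [← discounted_sub_nextValue hβ hh (π := X.priorityPolicy D) (i := j)]
    refine discounted_congr fun past s a ha => ?_
    rw [haction (mem_support_priorityPolicy.1 ha), add_sub_cancel_right]
  rw [actionValue, hvalue, ← haction ha]
  exact congrFun hvalue s

theorem abs_actionValue_le (hβ : β ∈ Set.Ico (0 : ℝ) 1) {B : ℝ} (hB : ∀ z, |c z| ≤ B)
    (z : X.State ω₀ × Bool) : |X.actionValue β D c z| ≤ B + β * ((1 - β)⁻¹ * B) := by
  refine (abs_add_le _ _).trans (add_le_add (hB z) ?_)
  rw [abs_mul, abs_of_nonneg hβ.1]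
  exact mul_le_mul_of_nonneg_left (abs_expectation_le _ fun _ => abs_discounted_le hβ hB) hβ.1

/-- The advantage of the active over the passive action in the state `s`, when the `D`-priority
policy is followed afterwards. -/
def advantage (X : POArm M L) {ω₀ : Belief M} (β : ℝ) (D : Set (X.State ω₀))
    (c : X.State ω₀ × Bool → ℝ) (s : X.State ω₀) : ℝ :=
  X.actionValue β D c (s, true) - X.actionValue β D c (s, false)

theorem exists_abs_advantage_le (hβ : β ∈ Set.Ico (0 : ℝ) 1) (hc : Memℓp c ∞) :
    ∃ B, ∀ D s, |X.advantage β D c s| ≤ B :=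
  (exists_abs_le_of_memℓp_infty hc).elim fun _ hB =>
    ⟨_, fun _ _ => (abs_sub _ _).trans (add_le_add (abs_actionValue_le hβ hB _)
      (abs_actionValue_le hβ hB _))⟩

theorem memℓp_advantage (hβ : β ∈ Set.Ico (0 : ℝ) 1) (hc : Memℓp c ∞) :
    Memℓp (X.advantage β D c) ∞ :=
  (exists_abs_advantage_le hβ hc).elim fun _ hB => memℓp_infty_of_abs_le (hB D)

theorem advantage_eq_sub_of_forall_discounted_eq {k : ℝ}
    (h : ∀ j, X.discounted β (X.priorityPolicy D) j c = k) (s : X.State ω₀) :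
    X.advantage β D c s = c (s, true) - c (s, false) := by
  simp only [advantage, actionValue, nextValue, h, expectation_const, add_sub_add_right_eq_sub]

end PriorityPolicy

/-- The indicator of the active action; as a reward it measures the time during which the arm is
active. -/
def activity {S : Type*} (z : S × Bool) : ℝ := if z.2 = true then 1 else 0

/-- The number of activations in the state and action `z` in excess of the `D`-priority policy. -/
def deviation {S : Type*} (D : Set S) (z : S × Bool) : ℝ := activity z - D.indicator 1 z.1

theorem abs_activity_le_one {S : Type*} (z : S × Bool) : |activity z| ≤ 1 := by
  rcases z with ⟨s, _ | _⟩ <;> simp [activity]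

theorem memℓp_activity {S : Type*} : Memℓp (activity (S := S)) ∞ :=
  memℓp_infty_of_abs_le abs_activity_le_one

theorem memℓp_deviation {S : Type*} (D : Set S) : Memℓp (deviation D) ∞ :=
  memℓp_activity.sub (memℓp_infty_comp (memℓp_infty_indicator (memℓp_infty_const 1) D) Prod.fst)

section PerformanceDifference

variable {D : Set (X.State ω₀)} {c : X.State ω₀ × Bool → ℝ} {π : X.Policy ω₀} {i : X.State ω₀}

theorem memℓp_deviation_mul_advantage (hβ : β ∈ Set.Ico (0 : ℝ) 1) (hc : Memℓp c ∞) :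
    Memℓp (fun z => deviation D z * X.advantage β D c z.1) ∞ :=
  (memℓp_deviation D).infty_mul (memℓp_infty_comp (memℓp_advantage hβ hc) Prod.fst)

theorem actionValue_eq_add_deviation_mul_advantage (hβ : β ∈ Set.Ico (0 : ℝ) 1) (hc : Memℓp c ∞)
    (z : X.State ω₀ × Bool) : X.actionValue β D c z =
      X.discounted β (X.priorityPolicy D) z.1 c + deviation D z * X.advantage β D c z.1 := by
  obtain ⟨s, a⟩ := z
  by_cases hs : s ∈ D
  · rw [discounted_priorityPolicy_eq_actionValue hβ hc (a := true) (iff_of_true rfl hs)]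
    cases a <;> simp [deviation, activity, advantage, hs]
  · rw [discounted_priorityPolicy_eq_actionValue hβ hc (a := false) (by simp [hs])]
    cases a <;> simp [deviation, activity, advantage, hs]

theorem discounted_eq_add_discounted_deviation_mul_advantage (hβ : β ∈ Set.Ico (0 : ℝ) 1)
    (hc : Memℓp c ∞) (D : Set (X.State ω₀)) (π : X.Policy ω₀) (i : X.State ω₀) :
    X.discounted β π i c = X.discounted β (X.priorityPolicy D) i c +
      X.discounted β π i fun z => deviation D z * X.advantage β D c z.1 := by
  have hV := memℓp_discounted hβ (X.priorityPolicy D) hc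
  have hsub : Memℓp (fun z : X.State ω₀ × Bool => X.discounted β (X.priorityPolicy D) z.1 c - β *
      X.nextValue z.2 (fun j => X.discounted β (X.priorityPolicy D) j c) z.1) ∞ :=
    (memℓp_infty_comp hV Prod.fst).sub ((memℓp_nextValue hV).const_mul β)
  rw [← discounted_sub_nextValue hβ hV (π := π),
    ← discounted_add hβ hsub (memℓp_deviation_mul_advantage hβ hc)]
  congr 1
  funext z
  have h := actionValue_eq_add_deviation_mul_advantage (D := D) hβ hc z
  rw [actionValue] at h
  linear_combination h

theorem discounted_eq_of_deviation_mul_advantage_eq_zero (hβ : β ∈ Set.Ico (0 : ℝ) 1)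
    (hc : Memℓp c ∞) (h : ∀ past s, ∀ a ∈ (π past s).support,
      deviation D (s, a) * X.advantage β D c s = 0) :
    X.discounted β π i c = X.discounted β (X.priorityPolicy D) i c := by
  rw [discounted_eq_add_discounted_deviation_mul_advantage hβ hc D π i, add_eq_left]
  exact discounted_eq_zero hβ h

theorem deviation_of_mem_support_priorityPolicy {D' : Set (X.State ω₀)}
    {past : List (X.State ω₀ × Bool)} {s : X.State ω₀} {a : Bool}
    (ha : a ∈ (X.priorityPolicy D' past s).support) :
    deviation D (s, a) = D'.indicator 1 s - D.indicator 1 s := by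
  have ha' : a = true ↔ s ∈ D' := mem_support_priorityPolicy.1 ha
  by_cases hs : s ∈ D' <;> simp [deviation, activity, ha', hs]

theorem advantage_congr (hβ : β ∈ Set.Ico (0 : ℝ) 1) (hc : Memℓp c ∞) {D' : Set (X.State ω₀)}
    (h : ∀ s, X.advantage β D c s ≠ 0 → (s ∈ D' ↔ s ∈ D)) :
    X.advantage β D' c = X.advantage β D c := by
  have hvalue (j : X.State ω₀) : X.discounted β (X.priorityPolicy D') j c =
      X.discounted β (X.priorityPolicy D) j c := by
    refine discounted_eq_of_deviation_mul_advantage_eq_zero hβ hc fun past s a ha => ?_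
    rw [deviation_of_mem_support_priorityPolicy ha, mul_eq_zero, or_iff_not_imp_right]
    intro hs
    exact sub_eq_zero.2 (Set.indicator_eq_indicator (h s hs) rfl)
  funext s
  simp only [advantage, actionValue, hvalue]

theorem tendsto_discounted_priorityPolicy (hβ : β ∈ Set.Ico (0 : ℝ) 1) (hc : Memℓp c ∞)
    {κ : Type*} {l : Filter κ} {u : κ → Set (X.State ω₀)} (hu : ∀ s, ∀ᶠ n in l, s ∈ u n ↔ s ∈ D) :
    Tendsto (fun n => X.discounted β (X.priorityPolicy (u n)) i c) l
      (𝓝 (X.discounted β (X.priorityPolicy D) i c)) := by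
  obtain ⟨B, hB⟩ := exists_abs_advantage_le hβ hc
  let e (n : κ) (z : X.State ω₀ × Bool) : ℝ :=
    (D.indicator 1 z.1 - (u n).indicator 1 z.1) * X.advantage β (u n) c z.1
  have heq (n : κ) : X.discounted β (X.priorityPolicy (u n)) i c =
      X.discounted β (X.priorityPolicy D) i c - X.discounted β (X.priorityPolicy D) i (e n) := by
    rw [discounted_eq_add_discounted_deviation_mul_advantage hβ hc (u n) (X.priorityPolicy D) i,
      eq_sub_iff_add_eq, add_right_inj]
    exact (discounted_congr fun past s a ha => by
      rw [deviation_of_mem_support_priorityPolicy ha]).symm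
  have hbound (n : κ) (z : X.State ω₀ × Bool) : |e n z| ≤ 1 * B := by
    rw [abs_mul]
    refine mul_le_mul ?_ (hB _ _) (abs_nonneg _) zero_le_one
    by_cases hD : z.1 ∈ D <;> by_cases hn : z.1 ∈ u n <;> simp [hD, hn]
  have hlim (z : X.State ω₀ × Bool) : Tendsto (fun n => e n z) l (𝓝 0) :=
    tendsto_const_nhds.congr' <| (hu z.1).mono fun n hn =>
      (mul_eq_zero_of_left (sub_eq_zero.2 (Set.indicator_eq_indicator hn.symm rfl)) _).symm
  have hzero := tendsto_discounted (π := X.priorityPolicy D) (i := i) hβ hbound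
    (memℓp_infty_const 0) hlim
  rw [discounted_const hβ, mul_zero] at hzero
  simpa only [heq, sub_zero] using tendsto_const_nhds.sub hzero

theorem tendsto_advantage (hβ : β ∈ Set.Ico (0 : ℝ) 1) (hc : Memℓp c ∞) {κ : Type*} {l : Filter κ}
    {u : κ → Set (X.State ω₀)} (hu : ∀ s, ∀ᶠ n in l, s ∈ u n ↔ s ∈ D) (s : X.State ω₀) :
    Tendsto (fun n => X.advantage β (u n) c s) l (𝓝 (X.advantage β D c s)) := by
  obtain ⟨B, hB⟩ := exists_abs_le_of_memℓp_infty hc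
  have haction (a : Bool) : Tendsto (fun n => X.actionValue β (u n) c (s, a)) l
      (𝓝 (X.actionValue β D c (s, a))) :=
    ((tendsto_expectation _ (fun _ _ => abs_discounted_le hβ hB)
      fun _ => tendsto_discounted_priorityPolicy hβ hc hu).const_mul β).const_add _
  exact (haction true).sub (haction false)

end PerformanceDifference

/-- The Bellman optimality equation for the `D`-priority policy: no deviation from it in a single
slot is profitable. -/
def IsBellmanOptimal (X : POArm M L) {ω₀ : Belief M} (β : ℝ) (D : Set (X.State ω₀))
    (c : X.State ω₀ × Bool → ℝ) : Prop :=
  ∀ z, deviation D z * X.advantage β D c z.1 ≤ 0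

section Bellman

variable {D : Set (X.State ω₀)} {c : X.State ω₀ × Bool → ℝ} {π : X.Policy ω₀} {i : X.State ω₀}

theorem isBellmanOptimal_iff : X.IsBellmanOptimal β D c ↔
    (∀ s ∈ D, 0 ≤ X.advantage β D c s) ∧ ∀ s ∉ D, X.advantage β D c s ≤ 0 := by
  rw [IsBellmanOptimal, Prod.forall, ← forall_and]
  refine forall_congr' fun s => ?_
  by_cases hs : s ∈ D <;> simp [deviation, activity, hs]

theorem IsBellmanOptimal.discounted_le (h : X.IsBellmanOptimal β D c)
    (hβ : β ∈ Set.Ico (0 : ℝ) 1) (hc : Memℓp c ∞) :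
    X.discounted β π i c ≤ X.discounted β (X.priorityPolicy D) i c := by
  rw [discounted_eq_add_discounted_deviation_mul_advantage hβ hc D π i, add_le_iff_nonpos_right]
  refine (discounted_mono hβ (memℓp_deviation_mul_advantage hβ hc) (memℓp_infty_const 0)
    fun _ s a _ => h (s, a)).trans_eq ?_
  rw [discounted_const hβ, mul_zero]

theorem IsBellmanOptimal.discounted_lt (h : X.IsBellmanOptimal β D c)
    (hβ : β ∈ Set.Ico (0 : ℝ) 1) (hc : Memℓp c ∞) (hi : 0 < X.advantage β D c i)
    (hπ : π [] i = PMF.pure false) :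
    X.discounted β π i c < X.discounted β (X.priorityPolicy D) i c := by
  have hiD : i ∈ D := by_contra fun hiD => hi.not_ge ((isBellmanOptimal_iff.1 h).2 i hiD)
  rw [discounted_eq_add_discounted_deviation_mul_advantage hβ hc D π i, add_lt_iff_neg_left]
  refine (discounted_le_of_nonpos hβ (memℓp_deviation_mul_advantage hβ hc)
    (fun _ s a _ => h (s, a)) hπ).trans_lt ?_
  simpa [deviation, activity, hiD] using hi

end Bellman

/-- The reward paid by the original arm. -/
def activeReward (X : POArm M L) {ω₀ : Belief M} (z : X.State ω₀ × Bool) : ℝ :=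
  if z.2 = true then X.reward z.1 else 0

theorem memℓp_activeReward : Memℓp (X.activeReward (ω₀ := ω₀)) ∞ := by
  have hreward : Memℓp (fun z : X.State ω₀ × Bool => X.reward z.1) ∞ := by
    refine memℓp_infty_of_abs_le (B := ∑ i, |∑ j, X.E i j * X.r i j|) fun z => ?_
    refine (Finset.abs_sum_le_sum_abs _ _).trans (Finset.sum_le_sum fun i _ => ?_)
    rw [abs_mul, abs_of_nonneg (z.1.1.2.1 i)]
    refine mul_le_of_le_one_left (abs_nonneg _) ?_
    rw [← z.1.1.2.2]
    exact Finset.single_le_sum (fun j _ => z.1.1.2.1 j) (Finset.mem_univ i)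
  exact memℓp_infty_ite hreward (memℓp_infty_const 0) (Prod.snd · = true)

theorem coeffA_eq_advantage (hβ : β ∈ Set.Ico (0 : ℝ) 1) (Ω : Set (X.State ω₀)) :
    X.coeffA β Ω = X.advantage β Ωᶜ activity := by
  funext s
  refine (congrArg (1 + β * ·) (tsum_p_sub_p_mul (memℓp_discounted hβ (X.priorityPolicy Ωᶜ)
    memℓp_activity) s)).trans ?_
  simp only [advantage, actionValue, activity, if_true, Bool.false_eq_true, if_false]
  ring

theorem coeffW_eq_advantage (hβ : β ∈ Set.Ico (0 : ℝ) 1) (Ω : Set (X.State ω₀)) :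
    X.coeffW β Ω = X.advantage β Ωᶜ X.activeReward := by
  funext s
  refine (congrArg (X.reward s.1 + β * ·) (tsum_p_sub_p_mul (memℓp_discounted hβ
    (X.priorityPolicy Ωᶜ) memℓp_activeReward) s)).trans ?_
  simp only [advantage, actionValue, activeReward, if_true, Bool.false_eq_true, if_false]
  ring

section ConservationLaw

variable {Ω : Set (X.State ω₀)} {π : X.Policy ω₀} {i : X.State ω₀}

theorem memℓp_coeffA (hβ : β ∈ Set.Ico (0 : ℝ) 1) : Memℓp (X.coeffA β Ω) ∞ := by
  rw [coeffA_eq_advantage hβ]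
  exact memℓp_advantage hβ memℓp_activity

theorem x_eq_toReal_occupationLaw (hβ : β ∈ Set.Ico (0 : ℝ) 1) (a : Bool) (ω : X.State ω₀) :
    X.x β a ω π i = (1 - β)⁻¹ * (occupationLaw hβ π i (ω, a)).toReal := by
  classical
  rw [x, discounted_eq_expectation hβ
    (memℓp_infty_ite (memℓp_infty_const 1) (memℓp_infty_const 0) _)]
  simp only [expectation, mul_ite, mul_one, mul_zero, tsum_ite_eq]

theorem memℓp_indicator_comp_fst {S : Type*} {u : S → ℝ} (hu : Memℓp u ∞) (D : Set (S × Bool)) :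
    Memℓp (D.indicator (u ∘ Prod.fst)) ∞ :=
  memℓp_infty_indicator (memℓp_infty_comp hu Prod.fst) D

theorem weightedSum_eq_discounted (hβ : β ∈ Set.Ico (0 : ℝ) 1) : X.weightedSum β Ω π i =
    X.discounted β π i ((Ω ×ˢ {true}).indicator (X.coeffA β Ω ∘ Prod.fst)) := by
  have hinj : Function.Injective fun ω : Ω => (ω.1, true) :=
    fun _ _ h => Subtype.ext (congrArg Prod.fst h)
  rw [discounted_eq_expectation hβ (memℓp_indicator_comp_fst (memℓp_coeffA hβ) _), expectation,
    ← hinj.tsum_eq, weightedSum, ← tsum_mul_left]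
  · refine tsum_congr fun ω => ?_
    rw [x_eq_toReal_occupationLaw hβ,
      Set.indicator_of_mem (Set.mk_mem_prod ω.2 (Set.mem_singleton _)), Function.comp_apply]
    ring
  · rintro ⟨s, a⟩ h
    obtain ⟨hs, rfl⟩ := Set.mem_of_indicator_ne_zero (right_ne_zero_of_mul h)
    exact ⟨⟨s, hs⟩, rfl⟩

theorem deviation_compl_mul {S : Type*} (Ω : Set S) (u : S → ℝ) (z : S × Bool) :
    deviation Ωᶜ z * u z.1 = (Ω ×ˢ {true}).indicator (u ∘ Prod.fst) z -
      (Ωᶜ ×ˢ {false}).indicator (u ∘ Prod.fst) z := by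
  obtain ⟨s, a⟩ := z
  by_cases hs : s ∈ Ω <;> cases a <;> simp [deviation, activity, hs]

theorem xAux_add_weightedSum (hβ : β ∈ Set.Ico (0 : ℝ) 1) :
    X.xAux β π i + X.weightedSum β Ω π i =
      (1 - β)⁻¹ - X.discounted β (X.priorityPolicy Ωᶜ) i activity +
        X.discounted β π i ((Ωᶜ ×ˢ {false}).indicator (X.coeffA β Ω ∘ Prod.fst)) := by
  have hxAux : X.xAux β π i = (1 - β)⁻¹ - X.discounted β π i activity := by
    rw [← mul_one (1 - β)⁻¹, ← discounted_const hβ,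
      ← discounted_sub hβ (memℓp_infty_const 1) memℓp_activity]
    refine discounted_congr fun _ s a _ => ?_
    cases a <;> simp [activity]
  have hdiff := discounted_eq_add_discounted_deviation_mul_advantage (X := X) hβ memℓp_activity Ωᶜ
    π i
  simp only [← coeffA_eq_advantage hβ, deviation_compl_mul] at hdiff
  rw [discounted_sub hβ (memℓp_indicator_comp_fst (memℓp_coeffA hβ) _)
    (memℓp_indicator_comp_fst (memℓp_coeffA hβ) _), ← weightedSum_eq_discounted hβ] at hdiff
  linear_combination hxAux - hdiff

theorem nonneg_of_forall_discounted_indicator_nonneg (hβ : β ∈ Set.Ico (0 : ℝ) 1)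
    {D : Set (X.State ω₀)} {a : Bool} {u : X.State ω₀ → ℝ} (hu : Memℓp u ∞) {s : X.State ω₀}
    (h : ∀ π, 0 ≤ X.discounted β π s ((D ×ˢ {a}).indicator (u ∘ Prod.fst))) (hs : s ∈ D) :
    0 ≤ u s := by
  classical
  by_contra! hneg
  let π : X.Policy ω₀ := fun _ t => PMF.pure (if t = s then a else !a)
  have hnonpos (past : List (X.State ω₀ × Bool)) (t : X.State ω₀) :
      ∀ b ∈ (π past t).support, (D ×ˢ {a}).indicator (u ∘ Prod.fst) (t, b) ≤ 0 := by
    intro b hb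
    obtain rfl := (PMF.mem_support_pure_iff _ _).1 hb
    by_cases hts : t = s
    · simpa [hts, hs] using hneg.le
    · simp [hts]
  have hle := discounted_le_of_nonpos hβ (memℓp_indicator_comp_fst hu _) hnonpos
    (congrArg PMF.pure (if_pos rfl))
  rw [Set.indicator_of_mem (Set.mk_mem_prod hs (Set.mem_singleton a))] at hle
  exact ((h π).trans hle).not_gt hneg

theorem PartialConservationLaw.coeffA_nonneg {F : Set (Set (X.State ω₀))}
    (h : X.PartialConservationLaw β F) (hβ : β ∈ Set.Ico (0 : ℝ) 1) (hΩ : Ω ∈ F)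
    (s : X.State ω₀) : 0 ≤ X.coeffA β Ω s := by
  by_cases hs : s ∈ Ω
  · refine nonneg_of_forall_discounted_indicator_nonneg (a := true) hβ (memℓp_coeffA hβ)
      (fun π => ?_) hs
    have hzero : X.weightedSum β Ω (X.priorityPolicy Ωᶜ) s = 0 := by
      rw [weightedSum_eq_discounted hβ]
      refine discounted_eq_zero hβ fun _ t a ha => Set.indicator_of_notMem ?_ _
      rintro ⟨ht, rfl⟩
      exact (mem_support_priorityPolicy.1 ha).1 rfl ht
    rw [← weightedSum_eq_discounted hβ, ← hzero,
      h.eq Ω hΩ _ s fun _ t ht => by simp [priorityPolicy, ht]]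
    exact h.le Ω hΩ π s
  · refine nonneg_of_forall_discounted_indicator_nonneg (a := false) (D := Ωᶜ) hβ (memℓp_coeffA hβ)
      (fun π => ?_) hs
    have hmin := h.le_aux Ω hΩ π s
    rw [← h.eq_aux Ω hΩ (X.priorityPolicy Set.univ) s fun _ t _ => by simp [priorityPolicy],
      xAux_add_weightedSum hβ, xAux_add_weightedSum hβ, add_le_add_iff_left] at hmin
    refine le_of_eq_of_le (discounted_eq_zero hβ fun _ t a ha => ?_).symm hmin
    refine Set.indicator_of_notMem ?_ _
    rintro ⟨-, rfl⟩
    exact Bool.false_ne_true ((mem_support_priorityPolicy.1 ha).2 trivial)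

end ConservationLaw

section Subsidy

/-- The total reward of a slot in the two-arm problem with subsidy `lam`. -/
def subsidizedReward (X : POArm M L) {ω₀ : Belief M} (lam : ℝ) (z : X.State ω₀ × Bool) : ℝ :=
  if z.2 = true then X.reward z.1 else lam

variable {D : Set (X.State ω₀)} {lam : ℝ}

theorem subsidizedReward_eq (z : X.State ω₀ × Bool) :
    X.subsidizedReward lam z = X.activeReward z - lam * activity z + lam := by
  obtain ⟨s, _ | _⟩ := z <;> simp [subsidizedReward, activeReward, activity]

theorem memℓp_subsidizedReward : Memℓp (X.subsidizedReward (ω₀ := ω₀) lam) ∞ := by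
  simp only [funext subsidizedReward_eq]
  exact (memℓp_activeReward.sub (memℓp_activity.const_mul lam)).add (memℓp_infty_const lam)

theorem advantage_subsidizedReward (hβ : β ∈ Set.Ico (0 : ℝ) 1) (s : X.State ω₀) :
    X.advantage β D (X.subsidizedReward lam) s =
      X.advantage β D X.activeReward s - lam * X.advantage β D activity s := by
  have hA := memℓp_discounted hβ (X.priorityPolicy D) memℓp_activity
  have hW := memℓp_discounted hβ (X.priorityPolicy D) memℓp_activeReward
  have hc : Memℓp (fun z : X.State ω₀ × Bool => X.activeReward z - lam * activity z) ∞ :=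
    memℓp_activeReward.sub (memℓp_activity.const_mul lam)
  have hV : Memℓp (fun j => X.discounted β (X.priorityPolicy D) j X.activeReward -
      lam * X.discounted β (X.priorityPolicy D) j activity) ∞ := hW.sub (hA.const_mul lam)
  have hvalue (j : X.State ω₀) : X.discounted β (X.priorityPolicy D) j (X.subsidizedReward lam) =
      X.discounted β (X.priorityPolicy D) j X.activeReward -
        lam * X.discounted β (X.priorityPolicy D) j activity + (1 - β)⁻¹ * lam := by
    rw [← discounted_const (X := X) (π := X.priorityPolicy D) (i := j) hβ,
      ← discounted_const_mul,
      ← discounted_sub hβ memℓp_activeReward (memℓp_activity.const_mul lam),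
      ← discounted_add hβ hc (memℓp_infty_const lam)]
    simp only [← subsidizedReward_eq]
  have haction (a : Bool) : X.actionValue β D (X.subsidizedReward lam) (s, a) =
      X.actionValue β D X.activeReward (s, a) - lam * X.actionValue β D activity (s, a) +
        (lam + β * ((1 - β)⁻¹ * lam)) := by
    simp only [actionValue, nextValue, hvalue, subsidizedReward_eq]
    rw [expectation_add _ hV (memℓp_infty_const _),
      expectation_sub _ hW (hA.const_mul lam), expectation_const_mul, expectation_const]
    ring
  simp only [advantage, haction]
  ring

theorem IsBellmanOptimal.isOptimalFrom (h : X.IsBellmanOptimal β D (X.subsidizedReward lam))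
    (hβ : β ∈ Set.Ico (0 : ℝ) 1) {π : X.Policy ω₀} (hπ : ∀ past s, ∀ a ∈ (π past s).support,
      deviation D (s, a) * X.advantage β D (X.subsidizedReward lam) s = 0) (i : X.State ω₀) :
    X.IsOptimalFrom β lam π i := fun _ =>
  (h.discounted_le hβ memℓp_subsidizedReward).trans_eq
    (discounted_eq_of_deviation_mul_advantage_eq_zero hβ memℓp_subsidizedReward hπ).symm

theorem IsBellmanOptimal.mem_passiveSet_iff
    (h : X.IsBellmanOptimal β D (X.subsidizedReward lam)) (hβ : β ∈ Set.Ico (0 : ℝ) 1)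
    {i : X.State ω₀} : i ∈ X.passiveSet β ω₀ lam ↔
      X.advantage β D (X.subsidizedReward lam) i ≤ 0 := by
  refine ⟨fun ⟨π, hπ, hopt⟩ => ?_, fun hi =>
    ⟨X.priorityPolicy {s | 0 < X.advantage β D (X.subsidizedReward lam) s},
      congrArg PMF.pure (decide_eq_false hi.not_gt), h.isOptimalFrom hβ (fun _ s a ha => ?_) i⟩⟩
  · by_contra! hi
    exact (h.discounted_lt hβ memℓp_subsidizedReward hi hπ).not_ge (hopt _)
  · obtain ⟨hD, hDc⟩ := isBellmanOptimal_iff.1 h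
    rw [deviation_of_mem_support_priorityPolicy ha, mul_eq_zero, or_iff_not_imp_right]
    refine fun hs => sub_eq_zero.2 (Set.indicator_eq_indicator ⟨fun hpos => ?_, fun hsD => ?_⟩ rfl)
    · exact by_contra fun hsD => (hDc s hsD).not_gt hpos
    · exact (hD s hsD).lt_of_ne' hs

end Subsidy

end POArm

section OrderTopology

variable {α ι : Type*} [LinearOrder α]

theorem eventually_atTop_lt_iff (f : ι → α) (a : α) (i : ι) :
    ∀ᶠ v : (Set.range f ∩ Set.Iic a : Set α) in atTop, (v : α) < f i ↔ a < f i := by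
  by_cases hi : a < f i
  · exact .of_forall fun v => iff_of_true (v.2.2.trans_lt hi) hi
  · filter_upwards [eventually_ge_atTop ⟨f i, Set.mem_range_self i, not_lt.1 hi⟩] with v hv
    exact iff_of_false (not_lt.2 hv) hi

variable [TopologicalSpace α] [OrderTopology α]

theorem eventually_nhdsGT_lt_iff (a b : α) : ∀ᶠ x in 𝓝[>] a, x < b ↔ a < b := by
  by_cases hab : a < b
  · filter_upwards [Ioo_mem_nhdsGT hab] with x hx
    exact iff_of_true hx.2 hab
  · filter_upwards [self_mem_nhdsWithin] with x hx
    exact iff_of_false (fun hxb => hab (hx.trans hxb)) hab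

theorem eventually_nhdsLT_lt_iff (a b : α) : ∀ᶠ x in 𝓝[<] a, x < b ↔ a ≤ b := by
  by_cases hab : a ≤ b
  · filter_upwards [self_mem_nhdsWithin] with x hx
    exact iff_of_true (hx.trans_le hab) hab
  · filter_upwards [Ioo_mem_nhdsLT (not_le.1 hab)] with x hx
    exact iff_of_false hx.1.not_gt hab

theorem eventually_nhdsGT_preimage_Ioi_eq {f : ι → α} {a : α} (ha : ¬MapClusterPt a cofinite f) :
    ∀ᶠ x in 𝓝[>] a, f ⁻¹' Set.Ioi x = f ⁻¹' Set.Ioi a := by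
  rw [mapClusterPt_iff_frequently] at ha
  push Not at ha
  obtain ⟨U, hU, hfin⟩ := ha
  simp only [eventually_cofinite, not_not] at hfin
  have hIcc : ∀ᶠ x in 𝓝[>] a, Set.Icc a x ⊆ U :=
    (tendsto_const_nhds.Icc (tendsto_id.mono_left nhdsWithin_le_nhds)).eventually
      (eventually_smallSets.2 ⟨U, hU, fun _ => id⟩)
  filter_upwards [hIcc, self_mem_nhdsWithin,
    (eventually_all_finite hfin).2 fun i _ => eventually_nhdsGT_lt_iff a (f i)] with x hxU hax hx
  ext i
  refine ⟨hax.trans, fun hi => ?_⟩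
  by_contra hxi
  exact hxi ((hx i (hxU ⟨hi.le, not_lt.1 hxi⟩)).2 hi)

end OrderTopology

theorem antitone_of_eventually_le_right {g : ℝ → ℝ} (hg : Continuous g) {Z : Set ℝ}
    (hZ : Z.Countable) (h : ∀ x ∉ Z, ∀ᶠ y in 𝓝[>] x, g y ≤ g x) : Antitone g := by
  intro a b hab
  by_contra! hlt
  -- A level `c` avoiding the values of `g` on `Z`: `g` is at most `c` immediately to the right of
  -- the last point at which it is at most `c`.
  obtain ⟨c, hc, hac, hcb⟩ := ((hZ.image g).dense_compl ℝ).exists_between hlt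
  have hcomp : IsCompact (Set.Icc a b ∩ {t | g t ≤ c}) :=
    isCompact_Icc.inter_right (isClosed_le hg continuous_const)
  obtain ⟨x, ⟨⟨hax, hxb⟩, (hxc : g x ≤ c)⟩, hmax⟩ :=
    hcomp.exists_isGreatest ⟨a, ⟨le_rfl, hab⟩, hac.le⟩
  have hxb' : x < b := hxb.lt_of_ne (by rintro rfl; exact hcb.not_ge hxc)
  have hev : ∀ᶠ y in 𝓝[>] x, g y ≤ c := by
    rcases hxc.lt_or_eq with hlt' | heq
    · exact (((hg.tendsto x).eventually_lt_const hlt').filter_mono nhdsWithin_le_nhds).mono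
        fun _ => le_of_lt
    · rw [← heq]
      exact h x fun hx => hc ⟨x, hx, heq⟩
  obtain ⟨y, hyc, hxy, hyb⟩ := (hev.and (Ioo_mem_nhdsGT hxb')).exists
  exact (hmax ⟨⟨hax.trans hxy.le, hyb.le⟩, hyc⟩).not_gt hxy

namespace POArm

variable {M L : ℕ} {X : POArm M L} {ω₀ : Belief M} {β : ℝ}

section ConstantPolicy

theorem advantage_univ_activity (hβ : β ∈ Set.Ico (0 : ℝ) 1) (s : X.State ω₀) :
    X.advantage β Set.univ activity s = 1 := by
  have hvalue (j : X.State ω₀) :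
      X.discounted β (X.priorityPolicy Set.univ) j activity = (1 - β)⁻¹ * 1 := by
    rw [← discounted_const hβ]
    exact discounted_congr fun _ _ _ ha => if_pos ((mem_support_priorityPolicy.1 ha).2 trivial)
  simp [advantage_eq_sub_of_forall_discounted_eq hvalue, activity]

theorem advantage_empty_subsidizedReward (hβ : β ∈ Set.Ico (0 : ℝ) 1) (lam : ℝ) (s : X.State ω₀) :
    X.advantage β ∅ (X.subsidizedReward lam) s = X.activeReward (s, true) - lam := by
  have hvalue (j : X.State ω₀) :
      X.discounted β (X.priorityPolicy ∅) j (X.subsidizedReward lam) = (1 - β)⁻¹ * lam := by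
    rw [← discounted_const hβ]
    exact discounted_congr fun _ _ _ ha => if_neg (mem_support_priorityPolicy.1 ha).1
  simp [advantage_eq_sub_of_forall_discounted_eq hvalue, subsidizedReward, activeReward]

theorem eventually_passiveSet_eq_empty (hβ : β ∈ Set.Ico (0 : ℝ) 1) :
    ∀ᶠ lam in atBot, X.passiveSet β ω₀ lam = ∅ := by
  obtain ⟨B, hB⟩ := exists_abs_advantage_le (X := X) (ω₀ := ω₀) hβ memℓp_activeReward
  filter_upwards [eventually_lt_atBot (-B)] with lam hlam
  have hpos (s : X.State ω₀) : 0 < X.advantage β Set.univ (X.subsidizedReward lam) s := by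
    rw [advantage_subsidizedReward hβ, advantage_univ_activity hβ, mul_one, sub_pos]
    exact hlam.trans_le (abs_le.1 (hB Set.univ s)).1
  have hopt : X.IsBellmanOptimal β Set.univ (X.subsidizedReward (ω₀ := ω₀) lam) :=
    isBellmanOptimal_iff.2 ⟨fun s _ => (hpos s).le, fun _ hs => (hs trivial).elim⟩
  exact Set.eq_empty_of_forall_notMem fun s hs =>
    (hpos s).not_ge ((hopt.mem_passiveSet_iff hβ).1 hs)

theorem eventually_passiveSet_eq_univ (hβ : β ∈ Set.Ico (0 : ℝ) 1) :
    ∀ᶠ lam in atTop, X.passiveSet β ω₀ lam = Set.univ := by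
  obtain ⟨B, hB⟩ := exists_abs_le_of_memℓp_infty (memℓp_activeReward (X := X) (ω₀ := ω₀))
  filter_upwards [eventually_ge_atTop B] with lam hlam
  have hnonpos (s : X.State ω₀) : X.advantage β ∅ (X.subsidizedReward lam) s ≤ 0 := by
    rw [advantage_empty_subsidizedReward hβ, sub_nonpos]
    exact (le_of_abs_le (hB _)).trans hlam
  have hopt : X.IsBellmanOptimal β ∅ (X.subsidizedReward (ω₀ := ω₀) lam) :=
    isBellmanOptimal_iff.2 ⟨fun _ hs => hs.elim, fun s _ => hnonpos s⟩
  exact Set.eq_univ_of_forall fun s => (hopt.mem_passiveSet_iff hβ).2 (hnonpos s)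

end ConstantPolicy

/-- `idx` is a marginal productivity index: when the states of larger index than `i` are active
afterwards, activating the arm in the state `i` gains reward at the rate `idx i` per additional
unit of active time, and the additional active time is nonnegative in every state. -/
structure IsMarginalIndex (X : POArm M L) {ω₀ : Belief M} (β : ℝ) (idx : X.State ω₀ → ℝ) :
    Prop where
  injective : Function.Injective idx
  nonneg : ∀ i s, 0 ≤ X.advantage β (idx ⁻¹' Set.Ioi (idx i)) activity s
  ne_zero : ∀ i, X.advantage β (idx ⁻¹' Set.Ioi (idx i)) activity i ≠ 0
  reward_eq : ∀ i, X.advantage β (idx ⁻¹' Set.Ioi (idx i)) X.activeReward i =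
    idx i * X.advantage β (idx ⁻¹' Set.Ioi (idx i)) activity i

section IndexChain

variable {F : Set (Set (X.State ω₀))} {C : X.State ω₀ → Set (X.State ω₀)}

theorem IsIndexChain.mem_iff (hC : X.IsIndexChain β F C) (i j : X.State ω₀) :
    j ∈ C i ↔ X.chainIndex β C j ≤ X.chainIndex β C i := by
  rcases eq_or_ne i j with rfl | hij
  · exact iff_of_true (hC.chain.self_mem i) le_rfl
  rcases hC.chain.total i j hij with h | h
  · exact iff_of_false (hC.chain.not_mem i j hij h) (hC.strict i j hij h).not_ge
  · exact iff_of_true (h.1 (hC.chain.self_mem j)) (hC.strict j i hij.symm h).le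

theorem IsIndexChain.injective_chainIndex (hC : X.IsIndexChain β F C) :
    Function.Injective (X.chainIndex β C) := by
  intro i j h
  by_contra hij
  rcases hC.chain.total i j hij with hlt | hlt
  · exact (hC.strict i j hij hlt).ne h
  · exact (hC.strict j i (Ne.symm hij) hlt).ne' h

theorem IsIndexChain.isMarginalIndex (hC : X.IsIndexChain β F C)
    (hF : X.PartialConservationLaw β F) (hβ : β ∈ Set.Ico (0 : ℝ) 1) :
    X.IsMarginalIndex β (X.chainIndex β C) := by
  have hactive (i : X.State ω₀) :
      X.chainIndex β C ⁻¹' Set.Ioi (X.chainIndex β C i) = (C i)ᶜ :=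
    Set.ext fun j => by simp [hC.mem_iff i j]
  refine ⟨hC.injective_chainIndex, fun i s => ?_, fun i => ?_, fun i => ?_⟩
  · rw [hactive, ← coeffA_eq_advantage hβ]
    exact hF.coeffA_nonneg hβ (hC.chain.mem_family i) s
  · rw [hactive, ← coeffA_eq_advantage hβ]
    exact hC.denom_ne_zero i
  · rw [hactive, ← coeffA_eq_advantage hβ, ← coeffW_eq_advantage hβ]
    exact (div_mul_cancel₀ _ (hC.denom_ne_zero i)).symm

end IndexChain

/-- The advantage of the active action under the subsidy `lam`, when the arm is active afterwards in
the states of index larger than `lam`. Its sign decides which action is optimal. -/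
def indexAdvantage (X : POArm M L) {ω₀ : Belief M} (β : ℝ) (idx : X.State ω₀ → ℝ) (lam : ℝ)
    (i : X.State ω₀) : ℝ :=
  X.advantage β (idx ⁻¹' Set.Ioi lam) (X.subsidizedReward lam) i

namespace IsMarginalIndex

variable {idx : X.State ω₀ → ℝ} {lam : ℝ} {i : X.State ω₀}

theorem indexAdvantage_self (h : X.IsMarginalIndex β idx) (hβ : β ∈ Set.Ico (0 : ℝ) 1)
    (i : X.State ω₀) : X.indexAdvantage β idx (idx i) i = 0 := by
  rw [indexAdvantage, advantage_subsidizedReward hβ, h.reward_eq, sub_self]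

theorem advantage_preimage_Ici (h : X.IsMarginalIndex β idx) (hβ : β ∈ Set.Ico (0 : ℝ) 1)
    (lam : ℝ) : X.advantage β (idx ⁻¹' Set.Ici lam) (X.subsidizedReward lam) =
      X.indexAdvantage β idx lam := by
  refine advantage_congr hβ memℓp_subsidizedReward fun s hs => ?_
  have hne : lam ≠ idx s := by
    rintro rfl
    exact hs (h.indexAdvantage_self hβ s)
  exact hne.le_iff_lt

theorem continuous_indexAdvantage (h : X.IsMarginalIndex β idx) (hβ : β ∈ Set.Ico (0 : ℝ) 1)
    (i : X.State ω₀) : Continuous fun lam => X.indexAdvantage β idx lam i := by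
  have htendsto {D : Set (X.State ω₀)} {l : Filter ℝ} (lam : ℝ) (hl : l ≤ 𝓝 lam)
      (hD : ∀ s, ∀ᶠ y in l, s ∈ idx ⁻¹' Set.Ioi y ↔ s ∈ D) :
      Tendsto (fun y => X.indexAdvantage β idx y i) l
        (𝓝 (X.advantage β D (X.subsidizedReward lam) i)) := by
    simp only [indexAdvantage, advantage_subsidizedReward hβ]
    exact (tendsto_advantage hβ memℓp_activeReward hD i).sub
      ((tendsto_id.mono_right hl).mul (tendsto_advantage hβ memℓp_activity hD i))
  refine continuous_iff_continuousAt.2 fun lam => continuousAt_iff_continuous_left'_right'.2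
    ⟨?_, htendsto lam nhdsWithin_le_nhds fun s => eventually_nhdsGT_lt_iff lam (idx s)⟩
  rw [ContinuousWithinAt, ← h.advantage_preimage_Ici hβ]
  exact htendsto lam nhdsWithin_le_nhds fun s => eventually_nhdsLT_lt_iff lam (idx s)

theorem advantage_activity_nonneg (h : X.IsMarginalIndex β idx) (hβ : β ∈ Set.Ico (0 : ℝ) 1)
    (lam : ℝ) (i : X.State ω₀) : 0 ≤ X.advantage β (idx ⁻¹' Set.Ioi lam) activity i := by
  rcases (Set.range idx ∩ Set.Iic lam).eq_empty_or_nonempty with hempty | hne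
  · have huniv : idx ⁻¹' Set.Ioi lam = Set.univ := Set.eq_univ_of_forall fun s =>
      lt_of_not_ge (α := ℝ) fun hs => hempty.subset ⟨Set.mem_range_self s, hs⟩
    rw [huniv, advantage_univ_activity hβ]
    exact zero_le_one
  · have := hne.to_subtype
    refine ge_of_tendsto' (tendsto_advantage hβ memℓp_activity
      (fun s => eventually_atTop_lt_iff idx lam s) i) ?_
    rintro ⟨_, ⟨k, rfl⟩, -⟩
    exact h.nonneg k i

theorem indexAdvantage_eq_of_preimage_eq (hβ : β ∈ Set.Ico (0 : ℝ) 1) {x y : ℝ}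
    (hy : idx ⁻¹' Set.Ioi y = idx ⁻¹' Set.Ioi x) (i : X.State ω₀) :
    X.indexAdvantage β idx y i = X.indexAdvantage β idx x i -
      (y - x) * X.advantage β (idx ⁻¹' Set.Ioi x) activity i := by
  rw [indexAdvantage, indexAdvantage, hy, advantage_subsidizedReward hβ,
    advantage_subsidizedReward hβ]
  ring

theorem eventually_advantage_activity_pos (h : X.IsMarginalIndex β idx)
    (hβ : β ∈ Set.Ico (0 : ℝ) 1) (i : X.State ω₀) :
    ∀ᶠ x in 𝓝[<] idx i, 0 < X.advantage β (idx ⁻¹' Set.Ioi x) activity i := by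
  have hlim : Tendsto (fun x => X.advantage β (idx ⁻¹' Set.Ioi x) activity i) (𝓝[<] idx i)
      (𝓝 (X.advantage β (idx ⁻¹' Set.Ici (idx i)) activity i)) :=
    tendsto_advantage hβ memℓp_activity (fun s => eventually_nhdsLT_lt_iff (idx i) (idx s)) i
  have hne : X.advantage β (idx ⁻¹' Set.Ici (idx i)) activity i ≠ 0 := by
    intro hzero
    refine h.ne_zero i ?_
    rw [advantage_congr (D := idx ⁻¹' Set.Ici (idx i)) hβ memℓp_activity fun s hs => ?_, hzero]
    have hsi : idx i ≠ idx s := fun his => hs (h.injective his ▸ hzero)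
    exact hsi.le_iff_lt.symm
  have hnonneg : 0 ≤ X.advantage β (idx ⁻¹' Set.Ici (idx i)) activity i :=
    ge_of_tendsto' hlim fun x => h.advantage_activity_nonneg hβ x i
  exact hlim.eventually_const_lt (hnonneg.lt_of_ne' hne)

theorem antitone_indexAdvantage (h : X.IsMarginalIndex β idx) (hβ : β ∈ Set.Ico (0 : ℝ) 1)
    (hidx : {v | MapClusterPt v cofinite idx}.Countable) (i : X.State ω₀) :
    Antitone fun lam => X.indexAdvantage β idx lam i := by
  refine antitone_of_eventually_le_right (h.continuous_indexAdvantage hβ i) hidx fun x hx => ?_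
  filter_upwards [eventually_nhdsGT_preimage_Ioi_eq hx, self_mem_nhdsWithin] with y hy hxy
  rw [indexAdvantage_eq_of_preimage_eq hβ hy, sub_le_self_iff]
  exact mul_nonneg (sub_nonneg.2 hxy.le) (h.advantage_activity_nonneg hβ x i)

theorem indexAdvantage_nonneg (h : X.IsMarginalIndex β idx) (hβ : β ∈ Set.Ico (0 : ℝ) 1)
    (hidx : {v | MapClusterPt v cofinite idx}.Countable) (hi : lam ≤ idx i) :
    0 ≤ X.indexAdvantage β idx lam i := by
  rw [← h.indexAdvantage_self hβ i]
  exact h.antitone_indexAdvantage hβ hidx i hi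

theorem indexAdvantage_nonpos (h : X.IsMarginalIndex β idx) (hβ : β ∈ Set.Ico (0 : ℝ) 1)
    (hidx : {v | MapClusterPt v cofinite idx}.Countable) (hi : idx i ≤ lam) :
    X.indexAdvantage β idx lam i ≤ 0 := by
  rw [← h.indexAdvantage_self hβ i]
  exact h.antitone_indexAdvantage hβ hidx i hi

theorem indexAdvantage_pos (h : X.IsMarginalIndex β idx) (hβ : β ∈ Set.Ico (0 : ℝ) 1)
    (hidx : {v | MapClusterPt v cofinite idx}.Countable) (hi : lam < idx i) :
    0 < X.indexAdvantage β idx lam i := by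
  obtain ⟨l, hl, hpos⟩ := (mem_nhdsLT_iff_exists_Ioo_subset' hi).1
    ((h.eventually_advantage_activity_pos hβ i).and (Ioo_mem_nhdsLT hi))
  obtain ⟨x, hx, hlx, hxi⟩ := (hidx.dense_compl ℝ).exists_between hl
  obtain ⟨hA, hlamx, -⟩ := hpos ⟨hlx, hxi⟩
  obtain ⟨y, hy, hxy, hyi⟩ :=
    ((eventually_nhdsGT_preimage_Ioi_eq hx).and (Ioo_mem_nhdsGT hxi)).exists
  calc 0 ≤ X.indexAdvantage β idx y i := h.indexAdvantage_nonneg hβ hidx hyi.le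
    _ < X.indexAdvantage β idx x i := by
      rw [indexAdvantage_eq_of_preimage_eq hβ hy]
      exact sub_lt_self _ (mul_pos (sub_pos.2 hxy) hA)
    _ ≤ X.indexAdvantage β idx lam i := h.antitone_indexAdvantage hβ hidx i hlamx.le

theorem isBellmanOptimal (h : X.IsMarginalIndex β idx) (hβ : β ∈ Set.Ico (0 : ℝ) 1)
    (hidx : {v | MapClusterPt v cofinite idx}.Countable) (lam : ℝ) :
    X.IsBellmanOptimal β (idx ⁻¹' Set.Ioi lam) (X.subsidizedReward lam) :=
  isBellmanOptimal_iff.2 ⟨fun _ hs => h.indexAdvantage_nonneg hβ hidx (le_of_lt hs),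
    fun _ hs => h.indexAdvantage_nonpos hβ hidx (not_lt.1 hs)⟩

theorem isOptimalFrom (h : X.IsMarginalIndex β idx) (hβ : β ∈ Set.Ico (0 : ℝ) 1)
    (hidx : {v | MapClusterPt v cofinite idx}.Countable) {π : X.Policy ω₀}
    (hπ : X.IsIndexPriorityPolicy idx lam π) (i : X.State ω₀) : X.IsOptimalFrom β lam π i := by
  refine (h.isBellmanOptimal hβ hidx lam).isOptimalFrom hβ (fun past s a ha => ?_) i
  rcases lt_trichotomy lam (idx s) with hs | rfl | hs
  · rw [hπ.1 past s hs, PMF.mem_support_pure_iff] at ha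
    simp [deviation, activity, ha, hs]
  · exact mul_eq_zero_of_right _ (h.indexAdvantage_self hβ s)
  · rw [hπ.2 past s hs, PMF.mem_support_pure_iff] at ha
    simp [deviation, activity, ha, hs.le]

theorem passiveSet_eq (h : X.IsMarginalIndex β idx) (hβ : β ∈ Set.Ico (0 : ℝ) 1)
    (hidx : {v | MapClusterPt v cofinite idx}.Countable) (lam : ℝ) :
    X.passiveSet β ω₀ lam = {i | idx i ≤ lam} := by
  ext i
  rw [(h.isBellmanOptimal hβ hidx lam).mem_passiveSet_iff hβ]
  exact ⟨fun hi => not_lt.1 fun hlt => (h.indexAdvantage_pos hβ hidx hlt).not_ge hi,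
    h.indexAdvantage_nonpos hβ hidx⟩

theorem whittleIndexable (h : X.IsMarginalIndex β idx) (hβ : β ∈ Set.Ico (0 : ℝ) 1)
    (hidx : {v | MapClusterPt v cofinite idx}.Countable) :
    X.WhittleIndexable β ω₀ where
  mono lam lam' hle := by
    rw [h.passiveSet_eq hβ hidx, h.passiveSet_eq hβ hidx]
    exact fun _ hi => le_trans hi hle
  eventually_empty := eventually_passiveSet_eq_empty hβ
  eventually_univ := eventually_passiveSet_eq_univ hβ

theorem isWhittleIndex (h : X.IsMarginalIndex β idx) (hβ : β ∈ Set.Ico (0 : ℝ) 1)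
    (hidx : {v | MapClusterPt v cofinite idx}.Countable) (i : X.State ω₀) :
    X.IsWhittleIndex β i (idx i) := by
  simp only [IsWhittleIndex, h.passiveSet_eq hβ hidx]
  exact isGLB_Ici

end IsMarginalIndex

end POArm

end

theorem theorem3_general {M L : ℕ} {X : POArm M L} {β : ℝ} (hβ : β ∈ Set.Ico (0 : ℝ) 1)
    {ω₀ : Belief M} {F : Set (Set (X.State ω₀))} (hF : X.PartialConservationLaw β F)
    {C : X.State ω₀ → Set (X.State ω₀)} (hC : X.IsIndexChain β F C)
    (hidx : {v | MapClusterPt v Filter.cofinite (X.chainIndex β C)}.Countable) :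
    (∀ lam π, X.IsIndexPriorityPolicy (X.chainIndex β C) lam π →
      ∀ i, X.IsOptimalFrom β lam π i) ∧
    X.WhittleIndexable β ω₀ ∧ ∀ i, X.IsWhittleIndex β i (X.chainIndex β C i) := by
  have h := hC.isMarginalIndex hF hβ
  exact ⟨fun _ _ => h.isOptimalFrom hβ hidx, h.whittleIndexable hβ hidx, h.isWhittleIndex hβ hidx⟩

theorem theorem3 {N : ℕ} {M L : Fin N → ℕ} (arm : ∀ n, POArm (M n) (L n))
    (β : ℝ) (hβ0 : 0 ≤ β) (hβ1 : β < 1) (ω₀ : ∀ n, Belief (M n))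
    (F : ∀ n, Set (Set ((arm n).State (ω₀ n))))
    (hPCL : ∀ n, (arm n).PCLIndexable β (F n))
    -- `C n` is the unique chain provided by PCL-indexability
    (C : ∀ n, (arm n).State (ω₀ n) → Set ((arm n).State (ω₀ n)))
    (hC : ∀ n, (arm n).IsIndexChain β (F n) (C n))
    (hlim : ∀ n, POArm.FinitelyManyLimitPoints ((arm n).chainIndex β (C n))) :
    (∀ n lam π, (arm n).IsIndexPriorityPolicy ((arm n).chainIndex β (C n)) lam π →
      ∀ i, (arm n).IsOptimalFrom β lam π i) ∧
    RMABWhittleIndexable arm β ω₀ ∧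
    ∀ n i, (arm n).IsWhittleIndex β i ((arm n).chainIndex β (C n) i) := by
  have h n := theorem3_general ⟨hβ0, hβ1⟩ (hPCL n).pcl (hC n) (hlim n).countable
  exact ⟨fun n => (h n).1, fun n => (h n).2.1, fun n => (h n).2.2⟩
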